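/- **Theorem 2.1 (Hessian Comparison Theorem).** Let $N$ be a connected smooth Riemannian manifold without boundary, $\Sigma_0\subset N$ a smooth embedded hypersurface oriented by a smooth unit normal field $\nu$, and let $\varrho\colon N\to\mathbb{R}$ be a signed distance to $\Sigma_0$, i.e. $|\varrho(x)|=\operatorname{dist}(x,\Sigma_0)$ for all $x\in N$ and $\varrho^{-1}(0)=\Sigma_0$. Let $\mathcal{U}\subset N$ be an open set on which $\varrho$ is regular: $\varrho$ is smooth on $\mathcal U$ and increases in the direction of $\nu$ along $\Sigma_0\cap\mathcal{U}$ (that is, $d\varrho(\nu)>0$ there). Assume that every $p\in\mathcal{U}$ with $\varrho(p)\ge 0$ is joined to $\Sigma_0$ by a minimizing geodesic (a smooth unit speed curve from a point of $\Sigma_0$ to $p$ of length $\operatorname{dist}(p,\Sigma_0)$) contained in $\mathcal{U}$. Let $G\colon\mathbb{R}\to\mathbb{R}$ be an even smooth function, let $h\colon\mathbb{R}\to\mathbb{R}$ be a solution of $h''-Gh=0$, and let $(d_*,d^*)$, $-\infty\le d_*<0<d^*\le+\infty$, be the maximal interval around $0$ on which $h$ is positive. Denote by $\bar\nabla\varrho$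 and $\bar\nabla^2\varrho$ the gradient and the Hessian of $\varrho$ and by $K_N$ the sectional curvature of $N$. (i) Suppose that $$K_N(v\wedge\bar\nabla\varrho(p))\ge -G(\varrho(p))$$ for every $p\in\mathcal{U}$ and every unit vector $v\in T_pN$ with $\langle v,\bar\nabla\varrho(p)\rangle=0$, and that $$\bar\nabla^2\varrho(w,w)\le\frac{h'(0)}{h(0)}\langle w,w\rangle$$ for every $w\in T_q\Sigma_0$, $q\in\Sigma_0\cap\mathcal{U}$. Then $$\bar\nabla^2\varrho(v,v)\le\frac{h'(\varrho(p))}{h(\varrho(p))}\langle v,v\rangle$$ for all $p\in\mathcal{U}$ with $0\le\varrho(p)<d^*$ and all $v\in T_pN$ with $\langle v,\bar\nabla\varrho(p)\rangle=0$. (ii) If instead both inequalities in the hypotheses of (i) are reversed, that is, $K_N(v\wedge\bar\nabla\varrho(p))\le -G(\varrho(p))$ and $\bar\nabla^2\varrho(w,w)\ge\frac{h'(0)}{h(0)}\langle w,w\rangle$ for all such $p,v,w$, then $$\bar\nabla^2\varrho(v,v)\ge\frac{h'(\varrho(p))}{h(\varrho(p))}\langle v,v\rangle$$ for all $p\in\mathcal{U}$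 with $0\le\varrho(p)<d^*$ and all $v\in T_pN$ with $\langle v,\bar\nabla\varrho(p)\rangle=0$. -/

import Mathlib

open Set Bundle Manifold
open scoped ContDiff Topology

noncomputable section

namespace RiemannianComparison

section Connection

variable {E : Type*} [NormedAddCommGroup E] [NormedSpace ℝ E] [FiniteDimensional ℝ E]
  {N : Type*} [TopologicalSpace N] [ChartedSpace E N] [IsManifold 𝓘(ℝ, E) ∞ N]

instance instFiniteDimensionalTangentSpace (p : N) :
    FiniteDimensional ℝ (TangentSpace 𝓘(ℝ, E) p) :=
  inferInstanceAs (FiniteDimensional ℝ E)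

variable [RiemannianBundle (fun p : N ↦ TangentSpace 𝓘(ℝ, E) p)]

instance instCompleteTangentSpace (p : N) :
    CompleteSpace (TangentSpace 𝓘(ℝ, E) p) :=
  FiniteDimensional.complete ℝ _

/-- The Koszul expression `K(X, Y, Z)`; the Levi-Civita connection is the one with
`2 ⟨∇_X Y, Z⟩ = K(X, Y, Z)`. -/
def koszul (X Y Z : ∀ p : N, TangentSpace 𝓘(ℝ, E) p) (p : N) : ℝ :=
  mvfderiv 𝓘(ℝ, E) (fun q ↦ inner ℝ (Y q) (Z q)) p (X p)
    + mvfderiv 𝓘(ℝ, E) (fun q ↦ inner ℝ (Z q) (X q)) p (Y p)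
    - mvfderiv 𝓘(ℝ, E) (fun q ↦ inner ℝ (X q) (Y q)) p (Z p)
    + inner ℝ (VectorField.mlieBracket 𝓘(ℝ, E) X Y p) (Z p)
    - inner ℝ (VectorField.mlieBracket 𝓘(ℝ, E) Y Z p) (X p)
    + inner ℝ (VectorField.mlieBracket 𝓘(ℝ, E) Z X p) (Y p)

/-- The Levi-Civita covariant derivative `∇_v Y` at `p`, for `v ∈ T_p N`, given by the Koszul
formula in an orthonormal basis of `T_p N`. (`FiberBundle.extend` extends a tangent vector
at `p` to a vector field which is smooth near `p`.) -/
def covDeriv (Y : ∀ p : N, TangentSpace 𝓘(ℝ, E) p) (p : N)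
    (v : TangentSpace 𝓘(ℝ, E) p) : TangentSpace 𝓘(ℝ, E) p :=
  ∑ i, ((1 / 2 : ℝ) * koszul (FiberBundle.extend E v) Y
      (FiberBundle.extend E (stdOrthonormalBasis ℝ (TangentSpace 𝓘(ℝ, E) p) i)) p)
    • stdOrthonormalBasis ℝ (TangentSpace 𝓘(ℝ, E) p) i

/-- The Riemann curvature
`R(X, Y) Z = ∇_X ∇_Y Z - ∇_Y ∇_X Z - ∇_[X, Y] Z` on vector fields. -/
def riemannCurv (X Y Z : ∀ p : N, TangentSpace 𝓘(ℝ, E) p) (p : N) : TangentSpace 𝓘(ℝ, E) p :=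
  covDeriv (fun q ↦ covDeriv Z q (Y q)) p (X p)
    - covDeriv (fun q ↦ covDeriv Z q (X q)) p (Y p)
    - covDeriv Z p (VectorField.mlieBracket 𝓘(ℝ, E) X Y p)

/-- The sectional curvature `K(v ∧ w)` of the plane spanned by `v, w ∈ T_p N`. -/
def sectionalCurv (p : N) (v w : TangentSpace 𝓘(ℝ, E) p) : ℝ :=
  inner ℝ (riemannCurv (FiberBundle.extend E v) (FiberBundle.extend E w)
      (FiberBundle.extend E w) p) v
    / (‖v‖ ^ 2 * ‖w‖ ^ 2 - inner ℝ v w ^ 2)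

variable (E) in
/-- The Riemannian gradient of a function. -/
def grad (f : N → ℝ) (p : N) : TangentSpace 𝓘(ℝ, E) p :=
  (InnerProductSpace.toDual ℝ (TangentSpace 𝓘(ℝ, E) p)).symm (mvfderiv 𝓘(ℝ, E) f p)

/-- The Riemannian Hessian `∇² f (v, w) = ⟨∇_v (grad f), w⟩`. -/
def hessian (f : N → ℝ) (p : N) (v w : TangentSpace 𝓘(ℝ, E) p) : ℝ :=
  inner ℝ (covDeriv (grad E f) p v) w

end Connection

section Hypersurface

variable (E : Type*) [NormedAddCommGroup E] [NormedSpace ℝ E] [FiniteDimensional ℝ E]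
  (F : Type*) [NormedAddCommGroup F] [NormedSpace ℝ F]
  {N : Type*} [MetricSpace N] [ChartedSpace E N] [IsManifold 𝓘(ℝ, E) ∞ N]
  [RiemannianBundle (fun p : N ↦ TangentSpace 𝓘(ℝ, E) p)]
  {S : Type*} [TopologicalSpace S] [ChartedSpace F S]

/-- `ι : S → N` is an embedded hypersurface, oriented by the smooth unit normal field `ν`. -/
structure IsOrientedHypersurface (ι : S → N) (ν : ∀ s : S, TangentSpace 𝓘(ℝ, E) (ι s)) :
    Prop where
  codim_one : Module.finrank ℝ F + 1 = Module.finrank ℝ E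
  embedding : IsSmoothEmbedding 𝓘(ℝ, F) 𝓘(ℝ, E) ∞ ι
  smooth_normal : ContMDiff 𝓘(ℝ, F) 𝓘(ℝ, E).tangent ∞
    (fun s ↦ (⟨ι s, ν s⟩ : TangentBundle 𝓘(ℝ, E) N))
  unit_normal : ∀ s, ‖ν s‖ = 1
  normal : ∀ s (w : TangentSpace 𝓘(ℝ, F) s),
    inner ℝ (mfderiv 𝓘(ℝ, F) 𝓘(ℝ, E) ι s w) (ν s) = 0

/-- `γ`, restricted to `[0, d]`, is a unit speed minimizing geodesic from the set `A` to `p`: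
a smooth unit speed curve from a point of `A` to `p` whose length `d` is the distance of `p`
to `A`. -/
structure IsMinimizingGeodesicFrom (A : Set N) (p : N) (d : ℝ) (γ : ℝ → N) : Prop where
  smooth : ContMDiffOn 𝓘(ℝ, ℝ) 𝓘(ℝ, E) ∞ γ (Icc 0 d)
  unit_speed : ∀ t ∈ Ioo 0 d, ‖mfderiv 𝓘(ℝ, ℝ) 𝓘(ℝ, E) γ t 1‖ = 1
  source : γ 0 ∈ A
  target : γ d = p
  length_eq : d = Metric.infDist p A

/-- `ϱ` is a signed distance function to the hypersurface `ι : S → N` oriented by `ν`, regular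
on the open set `U`, the sign being chosen such that `ϱ` increases in the direction of `ν`. -/
structure IsRegularSignedDist (ι : S → N) (ν : ∀ s : S, TangentSpace 𝓘(ℝ, E) (ι s))
    (U : Set N) (ϱ : N → ℝ) : Prop where
  abs_eq : ∀ x, |ϱ x| = Metric.infDist x (range ι)
  zero_set : ϱ ⁻¹' {0} = range ι
  isOpen : IsOpen U
  smooth : ContMDiffOn 𝓘(ℝ, E) 𝓘(ℝ, ℝ) ∞ ϱ U
  sign : ∀ s, ι s ∈ U → 0 < mvfderiv 𝓘(ℝ, E) ϱ (ι s) (ν s)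

end Hypersurface

/-- `(a, b)` is a maximal open interval on which `h` is positive; the endpoints may be
infinite. -/
structure IsMaximalPositivityInterval (h : ℝ → ℝ) (a b : EReal) : Prop where
  pos : ∀ t : ℝ, a < t → t < b → 0 < h t
  maximal : ∀ a' b' : EReal, a' ≤ a → b ≤ b' → (∀ t : ℝ, a' < t → t < b' → 0 < h t) →
    a' = a ∧ b' = b

end RiemannianComparison

end

noncomputable section

namespace RiemannianComparison

set_option linter.unusedSectionVars false

/-! ### Lie brackets as commutators of derivations -/

section Calculus

open Filter VectorField

variable {E : Type*} [NormedAddCommGroup E] [NormedSpace ℝ E]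
  {N : Type*} [TopologicalSpace N] [ChartedSpace E N] [IsManifold 𝓘(ℝ, E) ∞ N]

/-! Write `n` for the gradient of `ϱ` and `S = ∇n` for its Hessian operator. A unit speed curve `γ`
realizing the distance from the hypersurface satisfies `ϱ (γ t) = t`. Since `ϱ` is locally
1-Lipschitz where it is positive, equality in Cauchy-Schwarz gives `γ' = n`
(`IsMinimizingGeodesicFrom.mfderiv_eq_grad`). Every point of `U` with `ϱ > 0` is reached by such a
curve, so `‖n‖ = 1` there. Differentiating this identity gives `S n = 0` and the Riccati equation
`∇_n S + S² + R(·, n) n = 0` (`mvfderiv_hessian_grad`). The function `ψ = h' / h` satisfies the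
scalar equation `ψ' + ψ² = G`, and the theorem compares the two along `γ`.

Both cases are treated at once through a sign `σ = ±1`. The comparison is a first-touching argument
for `Q = σ (S - ψ (g - n ⊗ n)) - n ⊗ n`, with `ψ` perturbed by a small `ε > 0` so that the scalar
inequality and the initial inequality become strict. The term `-n ⊗ n` makes `Q` negative definite
on the whole tangent space, so the subbundle orthogonal to `n` never has to be handled. If `Q` first
degenerates at time `t`, a unit null vector `v` lies in the radical of `Q`, whence `v ⊥ n` and `S v
= ψ v`. For any extension `X` of `v` the terms containing `∇_n X` then cancel in the derivative of
`Q(X, X)` along `γ`, leaving `σ (-K - ψ² - ψ') < 0`. But `Q(X, X)` is nonpositive before `t` and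
vanishes at `t`, a contradiction (`riccatiForm_neg_of_riccati`). No parallel transport or Jacobi
field is needed. Letting the time tend to `ϱ p`, and then `ε` to `0`, gives the bound.

The connection is given by the Koszul formula applied to chosen extensions, so its tensoriality,
metric compatibility and vanishing torsion, as well as the tensoriality of the curvature in its last
slot, are derived first. -/

theorem isManifold_minSmoothness_two : IsManifold 𝓘(ℝ, E) (minSmoothness ℝ 2) N :=
  IsManifold.of_le (n := ∞) (by simpa using ENat.LEInfty.out)

theorem isManifold_minSmoothness_three : IsManifold 𝓘(ℝ, E) (minSmoothness ℝ 3) N :=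
  IsManifold.of_le (n := ∞) (by simpa using ENat.LEInfty.out)

theorem isManifold_top_add_one : IsManifold 𝓘(ℝ, E) (((⊤ : ℕ∞) : WithTop ℕ∞) + 1) N :=
  IsManifold.of_le (n := ∞) (by norm_cast)

/-- The derivative of a smooth function along a smooth vector field is smooth. -/
theorem contMDiffAt_mvfderiv_apply {f : N → ℝ} {X : ∀ p : N, TangentSpace 𝓘(ℝ, E) p} {p : N}
    (hf : ContMDiffAt 𝓘(ℝ, E) 𝓘(ℝ, ℝ) ∞ f p) (hX : CMDiffAt ∞ (T% X) p) :
    ContMDiffAt 𝓘(ℝ, E) 𝓘(ℝ, ℝ) ∞ (fun q ↦ mvfderiv 𝓘(ℝ, E) f q (X q)) p := by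
  have h1 := hf.mfderiv_const (m := ∞) (by norm_cast)
  have h2 := ContMDiffAt.clm_apply_of_inCoordinates (b₁ := id) (b₂ := f) (v := X)
    (ϕ := fun q ↦ mfderiv 𝓘(ℝ, E) 𝓘(ℝ, ℝ) f q) h1 hX hf
  rw [contMDiffAt_totalSpace] at h2
  refine h2.2.congr_of_eventuallyEq (Eventually.of_forall fun q ↦ ?_)
  simp [mvfderiv]
  rfl

theorem contMDiffAt_mlieBracket [CompleteSpace E] {X Y : ∀ p : N, TangentSpace 𝓘(ℝ, E) p} {p : N}
    (hX : CMDiffAt ∞ (T% X) p) (hY : CMDiffAt ∞ (T% Y) p) :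
    CMDiffAt ∞ (T% (mlieBracket 𝓘(ℝ, E) X Y)) p := by
  have := isManifold_top_add_one (E := E) (N := N)
  have := isManifold_minSmoothness_two (E := E) (N := N)
  exact ContMDiffAt.mlieBracket_vectorField (m := ⊤) (n := ⊤) hX hY (by simp)

theorem eventually_contMDiffAt_extend {p : N} (v : TangentSpace 𝓘(ℝ, E) p) :
    ∀ᶠ q in 𝓝 p, CMDiffAt ∞ (T% (FiberBundle.extend E v)) q := by
  obtain ⟨s, hs, h⟩ := FiberBundle.exists_contMDiffOn_extend 𝓘(ℝ, E) E (k := ∞) v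
  filter_upwards [eventually_mem_nhds_iff.2 hs] with q hq
  exact h.contMDiffAt hq

/-- The Lie bracket acts on functions as the commutator of derivations. -/
theorem mvfderiv_mlieBracket_apply [CompleteSpace E] {f : N → ℝ} {X Y : ∀ p : N, TangentSpace 𝓘(ℝ, E) p} {p : N}
    (hf : ∀ᶠ q in 𝓝 p, ContMDiffAt 𝓘(ℝ, E) 𝓘(ℝ, ℝ) ∞ f q)
    (hX : ∀ᶠ q in 𝓝 p, CMDiffAt ∞ (T% X) q) (hY : ∀ᶠ q in 𝓝 p, CMDiffAt ∞ (T% Y) q) :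
    mvfderiv 𝓘(ℝ, E) f p (mlieBracket 𝓘(ℝ, E) X Y p)
      = mvfderiv 𝓘(ℝ, E) (fun q ↦ mvfderiv 𝓘(ℝ, E) f q (Y q)) p (X p)
        - mvfderiv 𝓘(ℝ, E) (fun q ↦ mvfderiv 𝓘(ℝ, E) f q (X q)) p (Y p) := by
  have := isManifold_minSmoothness_three (E := E) (N := N)
  have := isManifold_minSmoothness_two (E := E) (N := N)
  rcases subsingleton_or_nontrivial E with hE | hE
  · have h0 : ∀ v : TangentSpace 𝓘(ℝ, E) p, v = 0 := fun v ↦ @Subsingleton.elim E _ v 0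
    simp [h0 (X p), h0 (Y p), h0 (mlieBracket 𝓘(ℝ, E) X Y p)]
  -- The Jacobi identities for `X, Y, Z` and for `X, Y, f • Z` are compared; since `Z p ≠ 0`, the
  -- coefficient of `Z p` in the difference must vanish, and this is the commutator identity.
  obtain ⟨z, hz⟩ : ∃ z : TangentSpace 𝓘(ℝ, E) p, z ≠ 0 := exists_ne (0 : E)
  set Z := FiberBundle.extend E z with hZdef
  have hZp : Z p = z := by simp [Z]
  have hZ : ∀ᶠ q in 𝓝 p, CMDiffAt ∞ (T% Z) q := eventually_contMDiffAt_extend z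
  have bracket_smul : ∀ {W : ∀ p : N, TangentSpace 𝓘(ℝ, E) p},
      (∀ᶠ q in 𝓝 p, CMDiffAt ∞ (T% W) q) →
      mlieBracket 𝓘(ℝ, E) W (f • Z) =ᶠ[𝓝 p]
        (fun q ↦ mvfderiv 𝓘(ℝ, E) f q (W q)) • Z + f • mlieBracket 𝓘(ℝ, E) W Z := by
    intro W hW
    filter_upwards [hf, hZ] with q hfq hZq
    simpa using! mlieBracket_smul_right (V := W) (hfq.mdifferentiableAt (by simp))
      (hZq.mdifferentiableAt (by simp))
  have key : ∀ {V W : ∀ p : N, TangentSpace 𝓘(ℝ, E) p},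
      (∀ᶠ q in 𝓝 p, CMDiffAt ∞ (T% V) q) → (∀ᶠ q in 𝓝 p, CMDiffAt ∞ (T% W) q) →
      mlieBracket 𝓘(ℝ, E) V (mlieBracket 𝓘(ℝ, E) W (f • Z)) p =
        mvfderiv 𝓘(ℝ, E) (fun q ↦ mvfderiv 𝓘(ℝ, E) f q (W q)) p (V p) • Z p
        + mvfderiv 𝓘(ℝ, E) f p (W p) • mlieBracket 𝓘(ℝ, E) V Z p
        + (mvfderiv 𝓘(ℝ, E) f p (V p) • mlieBracket 𝓘(ℝ, E) W Z p
        + f p • mlieBracket 𝓘(ℝ, E) V (mlieBracket 𝓘(ℝ, E) W Z) p) := by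
    intro V W hV hW
    have e1 := (EventuallyEq.refl (𝓝 p) V).mlieBracket_vectorField_eq (I := 𝓘(ℝ, E))
      (bracket_smul hW)
    have d1 := (contMDiffAt_mvfderiv_apply hf.self_of_nhds hW.self_of_nhds).mdifferentiableAt
      (by simp)
    have d2 := hZ.self_of_nhds.mdifferentiableAt (n := ∞) (by simp)
    have d3 := hf.self_of_nhds.mdifferentiableAt (n := ∞) (by simp)
    have d4 := (contMDiffAt_mlieBracket hW.self_of_nhds hZ.self_of_nhds).mdifferentiableAt
      (by simp)
    rw [e1, mlieBracket_add_right (d1.smul_section d2) (d3.smul_section d4),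
      mlieBracket_smul_right d1 d2, mlieBracket_smul_right d3 d4]
  have two : minSmoothness ℝ 2 ≤ (∞ : WithTop ℕ∞) := by simpa using ENat.LEInfty.out
  have jac := leibniz_identity_mlieBracket_apply (I := 𝓘(ℝ, E)) (U := X) (V := Y) (W := Z) (x := p)
    (hX.self_of_nhds.of_le two) (hY.self_of_nhds.of_le two) (hZ.self_of_nhds.of_le two)
  have jacf := leibniz_identity_mlieBracket_apply (I := 𝓘(ℝ, E)) (U := X) (V := Y) (W := f • Z)
    (x := p) (hX.self_of_nhds.of_le two) (hY.self_of_nhds.of_le two)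
    ((hf.self_of_nhds.smul_section hZ.self_of_nhds).of_le two)
  have hXY : ∀ᶠ q in 𝓝 p, CMDiffAt ∞ (T% (mlieBracket 𝓘(ℝ, E) X Y)) q := by
    filter_upwards [hX, hY] with q h1 h2 using contMDiffAt_mlieBracket h1 h2
  rw [key hX hY, key hY hX, (bracket_smul hXY).self_of_nhds] at jacf
  simp only [Pi.add_apply, Pi.smul_apply', jac, hZp] at jacf
  have : (mvfderiv 𝓘(ℝ, E) f p (mlieBracket 𝓘(ℝ, E) X Y p)
      - (mvfderiv 𝓘(ℝ, E) (fun q ↦ mvfderiv 𝓘(ℝ, E) f q (Y q)) p (X p)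
        - mvfderiv 𝓘(ℝ, E) (fun q ↦ mvfderiv 𝓘(ℝ, E) f q (X q)) p (Y p))) • z = 0 := by
    linear_combination (norm := module) (-1 : ℝ) • jacf
  exact sub_eq_zero.1 ((smul_eq_zero.1 this).resolve_right hz)

end Calculus

/-! ### The Koszul formula defines the Levi-Civita connection -/

section LeviCivita

open Filter VectorField

variable {E : Type*} [NormedAddCommGroup E] [NormedSpace ℝ E] [FiniteDimensional ℝ E]
  {N : Type*} [TopologicalSpace N] [ChartedSpace E N] [IsManifold 𝓘(ℝ, E) ∞ N]
  [RiemannianBundle (fun p : N ↦ TangentSpace 𝓘(ℝ, E) p)]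
  [IsContMDiffRiemannianBundle 𝓘(ℝ, E) ∞ E (fun p : N ↦ TangentSpace 𝓘(ℝ, E) p)]
  {X Y Z W : ∀ p : N, TangentSpace 𝓘(ℝ, E) p} {p : N}

theorem mdifferentiableAt_inner (hY : MDiffAt (T% Y) p) (hZ : MDiffAt (T% Z) p) :
    MDiffAt (fun q ↦ (inner ℝ (Y q) (Z q) : ℝ)) p :=
  MDifferentiableAt.inner_bundle (IB := 𝓘(ℝ, E)) (F := E)
    (E := fun p : N ↦ TangentSpace 𝓘(ℝ, E) p) (b := id) hY hZ

theorem contMDiffAt_inner (hY : CMDiffAt ∞ (T% Y) p) (hZ : CMDiffAt ∞ (T% Z) p) :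
    CMDiffAt ∞ (fun q ↦ (inner ℝ (Y q) (Z q) : ℝ)) p :=
  ContMDiffAt.inner_bundle (IB := 𝓘(ℝ, E)) (F := E)
    (E := fun p : N ↦ TangentSpace 𝓘(ℝ, E) p) (b := id) hY hZ

/-- Replacing `X` by `f X` produces derivatives of `f` along `Y` and `Z` both from the inner
products and from the brackets, and these cancel in pairs. The same happens in the slot of `Z`. -/
theorem tensorialAt_koszul_left (hY : MDiffAt (T% Y) p) (hZ : MDiffAt (T% Z) p) :
    TensorialAt 𝓘(ℝ, E) E (fun X ↦ koszul X Y Z p) p where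
  smul {f X} hf hX := by
    have := isManifold_minSmoothness_two (E := E) (N := N)
    simp only [koszul, Pi.smul_apply', inner_smul_left, inner_smul_right, RCLike.conj_to_real]
    rw [mvfderiv_fun_mul hf (mdifferentiableAt_inner hZ hX), mvfderiv_fun_mul hf (mdifferentiableAt_inner hX hY),
      mlieBracket_smul_left hf hX, mlieBracket_smul_right hf hX]
    simp [inner_add_left, inner_smul_left]
    rw [real_inner_comm (X p) (Z p)]
    ring
  add {X X'} hX hX' := by
    have := isManifold_minSmoothness_two (E := E) (N := N)
    simp only [koszul, Pi.add_apply, inner_add_left, inner_add_right]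
    rw [mvfderiv_fun_add (mdifferentiableAt_inner hZ hX) (mdifferentiableAt_inner hZ hX'),
      mvfderiv_fun_add (mdifferentiableAt_inner hX hY) (mdifferentiableAt_inner hX' hY),
      mlieBracket_add_left hX hX', mlieBracket_add_right hX hX']
    simp [inner_add_left]
    ring

theorem tensorialAt_koszul_right (hX : MDiffAt (T% X) p) (hY : MDiffAt (T% Y) p) :
    TensorialAt 𝓘(ℝ, E) E (fun Z ↦ koszul X Y Z p) p where
  smul {f Z} hf hZ := by
    have := isManifold_minSmoothness_two (E := E) (N := N)
    simp only [koszul, Pi.smul_apply', inner_smul_left, inner_smul_right, RCLike.conj_to_real]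
    rw [mvfderiv_fun_mul hf (mdifferentiableAt_inner hY hZ), mvfderiv_fun_mul hf (mdifferentiableAt_inner hZ hX),
      mlieBracket_smul_left hf hZ, mlieBracket_smul_right hf hZ]
    simp [inner_add_left, inner_smul_left]
    rw [real_inner_comm (Y p) (Z p)]
    ring
  add {Z Z'} hZ hZ' := by
    have := isManifold_minSmoothness_two (E := E) (N := N)
    simp only [koszul, Pi.add_apply, inner_add_left, inner_add_right]
    rw [mvfderiv_fun_add (mdifferentiableAt_inner hY hZ) (mdifferentiableAt_inner hY hZ'),
      mvfderiv_fun_add (mdifferentiableAt_inner hZ hX) (mdifferentiableAt_inner hZ' hX),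
      mlieBracket_add_left hZ hZ', mlieBracket_add_right hZ hZ']
    simp [inner_add_left]
    ring

/-- The Koszul formula as a pairing of tangent vectors. -/
theorem exists_clm_inner_covDeriv (hY : MDiffAt (T% Y) p) :
    ∃ B : TangentSpace 𝓘(ℝ, E) p →L[ℝ] TangentSpace 𝓘(ℝ, E) p →L[ℝ] ℝ,
      (∀ v w, inner ℝ (covDeriv Y p v) w = B v w) ∧
      ∀ {X Z : ∀ p : N, TangentSpace 𝓘(ℝ, E) p}, MDiffAt (T% X) p → MDiffAt (T% Z) p →
        2 * B (X p) (Z p) = koszul X Y Z p := by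
  set B := TensorialAt.mkHom₂ (I := 𝓘(ℝ, E)) (F := E) (F' := E)
    (fun X Z ↦ koszul X Y Z p) p
    (fun Z hZ ↦ tensorialAt_koszul_left hY hZ) (fun X hX ↦ tensorialAt_koszul_right hX hY) with hB
  refine ⟨(1 / 2 : ℝ) • B, fun v w ↦ ?_, fun hX hZ ↦ ?_⟩
  · set b := stdOrthonormalBasis ℝ (TangentSpace 𝓘(ℝ, E) p)
    have hv : ∀ i, koszul (FiberBundle.extend E v) Y (FiberBundle.extend E (b i)) p
        = B v (b i) := fun i ↦ by
      rw [hB, TensorialAt.mkHom₂_apply_eq_extend]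
    conv_rhs => rw [← b.sum_repr' w]
    simp only [covDeriv, sum_inner, inner_smul_left, map_sum, map_smul, smul_eq_mul]
    refine Finset.sum_congr rfl fun i _ ↦ ?_
    rw [hv]
    simp
    ring
  · rw [hB]
    simp [TensorialAt.mkHom₂_apply _ _ hX hZ]

theorem covDeriv_add_right (hY : MDiffAt (T% Y) p) (v w : TangentSpace 𝓘(ℝ, E) p) :
    covDeriv Y p (v + w) = covDeriv Y p v + covDeriv Y p w := by
  obtain ⟨B, hB, -⟩ := exists_clm_inner_covDeriv hY
  refine ext_inner_right ℝ fun u ↦ ?_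
  simp [inner_add_left, hB]

theorem covDeriv_smul_right (hY : MDiffAt (T% Y) p) (c : ℝ) (v : TangentSpace 𝓘(ℝ, E) p) :
    covDeriv Y p (c • v) = c • covDeriv Y p v := by
  obtain ⟨B, hB, -⟩ := exists_clm_inner_covDeriv hY
  refine ext_inner_right ℝ fun u ↦ ?_
  simp [inner_smul_left, hB]

theorem covDeriv_sub_right (hY : MDiffAt (T% Y) p) (v w : TangentSpace 𝓘(ℝ, E) p) :
    covDeriv Y p (v - w) = covDeriv Y p v - covDeriv Y p w := by
  rw [sub_eq_add_neg, covDeriv_add_right hY, ← neg_one_smul ℝ w, covDeriv_smul_right hY]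
  module

theorem two_mul_inner_covDeriv (hX : MDiffAt (T% X) p) (hY : MDiffAt (T% Y) p)
    (hZ : MDiffAt (T% Z) p) :
    2 * inner ℝ (covDeriv Y p (X p)) (Z p) = koszul X Y Z p := by
  obtain ⟨B, hB, hB'⟩ := exists_clm_inner_covDeriv hY
  rw [hB, hB' hX hZ]

/-- The Levi-Civita connection is metric. -/
theorem mvfderiv_inner_apply (hY : MDiffAt (T% Y) p) (hZ : MDiffAt (T% Z) p)
    (v : TangentSpace 𝓘(ℝ, E) p) :
    mvfderiv 𝓘(ℝ, E) (fun q ↦ inner ℝ (Y q) (Z q)) p v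
      = inner ℝ (covDeriv Y p v) (Z p) + inner ℝ (Y p) (covDeriv Z p v) := by
  have hX := FiberBundle.mdifferentiableAt_extend 𝓘(ℝ, E) E v
  -- In the sum of the Koszul formulas for `(X, Y, Z)` and `(X, Z, Y)` all brackets cancel, and only
  -- twice the derivative of `⟨Y, Z⟩` along `X` is left.
  have h1 := two_mul_inner_covDeriv hX hY hZ
  have h2 := two_mul_inner_covDeriv hX hZ hY
  have e1 : (fun q ↦ (inner ℝ (Z q) (Y q) : ℝ)) = fun q ↦ inner ℝ (Y q) (Z q) :=
    funext fun q ↦ real_inner_comm _ _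
  have e2 : (fun q ↦ (inner ℝ (FiberBundle.extend E v q) (Z q) : ℝ))
      = fun q ↦ inner ℝ (Z q) (FiberBundle.extend E v q) :=
    funext fun q ↦ real_inner_comm _ _
  have e3 : (fun q ↦ (inner ℝ (Y q) (FiberBundle.extend E v q) : ℝ))
      = fun q ↦ inner ℝ (FiberBundle.extend E v q) (Y q) :=
    funext fun q ↦ real_inner_comm _ _
  simp only [koszul, e1, e2, e3, FiberBundle.extend_apply_self] at h1 h2
  rw [mlieBracket_swap_apply (V := Z) (W := Y), mlieBracket_swap_apply (V := Y)
    (W := FiberBundle.extend E v), mlieBracket_swap_apply (V := Z)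
    (W := FiberBundle.extend E v)] at *
  simp only [inner_neg_left] at h1 h2
  rw [real_inner_comm _ (Y p)]
  linarith

/-- The Levi-Civita connection is torsion free. -/
theorem covDeriv_sub_covDeriv (hX : MDiffAt (T% X) p) (hY : MDiffAt (T% Y) p) :
    covDeriv Y p (X p) - covDeriv X p (Y p) = mlieBracket 𝓘(ℝ, E) X Y p := by
  refine ext_inner_right ℝ fun u ↦ ?_
  have hZ := FiberBundle.mdifferentiableAt_extend 𝓘(ℝ, E) E u
  have h1 := two_mul_inner_covDeriv hX hY hZ
  have h2 := two_mul_inner_covDeriv hY hX hZ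
  have e1 : (fun q ↦ (inner ℝ (FiberBundle.extend E u q) (X q) : ℝ))
      = fun q ↦ inner ℝ (X q) (FiberBundle.extend E u q) :=
    funext fun q ↦ real_inner_comm _ _
  have e2 : (fun q ↦ (inner ℝ (Y q) (FiberBundle.extend E u q) : ℝ))
      = fun q ↦ inner ℝ (FiberBundle.extend E u q) (Y q) :=
    funext fun q ↦ real_inner_comm _ _
  have e3 : (fun q ↦ (inner ℝ (Y q) (X q) : ℝ)) = fun q ↦ inner ℝ (X q) (Y q) :=
    funext fun q ↦ real_inner_comm _ _
  simp only [koszul, e1, e2, e3, FiberBundle.extend_apply_self] at h1 h2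
  rw [mlieBracket_swap_apply (V := Y) (W := X), mlieBracket_swap_apply (V := X)
    (W := FiberBundle.extend E u)] at h2
  rw [mlieBracket_swap_apply (V := Y) (W := FiberBundle.extend E u)] at h1
  simp only [inner_neg_left] at h1 h2
  rw [inner_sub_left]
  linarith

/-- Metric compatibility determines `⟨∇_v Y, u⟩` from the derivative of `⟨Y, W⟩` and the value of
`Y` at `p`, where `W` extends `u`; both depend linearly on `Y`. The same description yields
locality. -/
theorem covDeriv_sub (hY : MDiffAt (T% Y) p) (hZ : MDiffAt (T% Z) p)
    (v : TangentSpace 𝓘(ℝ, E) p) :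
    covDeriv (Y - Z) p v = covDeriv Y p v - covDeriv Z p v := by
  refine ext_inner_right ℝ fun u ↦ ?_
  have hW := FiberBundle.mdifferentiableAt_extend 𝓘(ℝ, E) E u
  have h1 := mvfderiv_inner_apply hY hW v
  have h2 := mvfderiv_inner_apply hZ hW v
  have h3 := mvfderiv_inner_apply (mdifferentiableAt_sub_section hY hZ) hW v
  simp only [Pi.sub_apply, inner_sub_left] at h3 ⊢
  rw [mvfderiv_fun_sub (mdifferentiableAt_inner hY hW) (mdifferentiableAt_inner hZ hW)] at h3
  simp only [_root_.sub_apply, FiberBundle.extend_apply_self] at h1 h2 h3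
  linarith

theorem mvfderiv_congr_of_eventuallyEq {f g : N → ℝ} (h : f =ᶠ[𝓝 p] g) :
    mvfderiv 𝓘(ℝ, E) f p = mvfderiv 𝓘(ℝ, E) g p := by
  ext v
  simp only [mvfderiv, ContinuousLinearMap.comp_apply]
  rw [h.mfderiv_eq]
  simp
  rfl

theorem covDeriv_congr (hY : MDiffAt (T% Y) p) (h : Y =ᶠ[𝓝 p] Z)
    (v : TangentSpace 𝓘(ℝ, E) p) :
    covDeriv Y p v = covDeriv Z p v := by
  refine ext_inner_right ℝ fun u ↦ ?_
  have hZ : MDiffAt (T% Z) p := hY.congr_of_eventuallyEq (h.mono fun q hq ↦ by simp [hq])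
  have hW := FiberBundle.mdifferentiableAt_extend 𝓘(ℝ, E) E u
  have h1 := mvfderiv_inner_apply hY hW v
  have h2 := mvfderiv_inner_apply hZ hW v
  have h3 : (fun q ↦ (inner ℝ (Y q) (FiberBundle.extend E u q) : ℝ)) =ᶠ[𝓝 p]
      fun q ↦ inner ℝ (Z q) (FiberBundle.extend E u q) := h.mono fun q hq ↦ by simp [hq]
  rw [mvfderiv_congr_of_eventuallyEq h3] at h1
  simp only [FiberBundle.extend_apply_self, h.self_of_nhds] at h1 h2
  linarith

end LeviCivita

/-! ### Smoothness of covariant derivatives and symmetry of the Hessian -/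

section Smoothness

open Filter VectorField

variable {E : Type*} [NormedAddCommGroup E] [NormedSpace ℝ E] [FiniteDimensional ℝ E]
  {N : Type*} [TopologicalSpace N] [ChartedSpace E N] [IsManifold 𝓘(ℝ, E) ∞ N]

theorem contMDiffAt_det {ι : Type*} [Fintype ι] [DecidableEq ι] {A : N → Matrix ι ι ℝ} {p : N}
    (hA : ∀ i j, CMDiffAt ∞ (fun q ↦ A q i j) p) : CMDiffAt ∞ (fun q ↦ (A q).det) p := by
  simp only [Matrix.det_apply']
  exact contMDiffAt_finsetSum fun σ _ ↦
    contMDiffAt_const.mul (contMDiffAt_finsetProd fun i _ ↦ hA _ _)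

variable [RiemannianBundle (fun p : N ↦ TangentSpace 𝓘(ℝ, E) p)]
  [IsContMDiffRiemannianBundle 𝓘(ℝ, E) ∞ E (fun p : N ↦ TangentSpace 𝓘(ℝ, E) p)]
  {X Y Z W : ∀ p : N, TangentSpace 𝓘(ℝ, E) p} {p : N}

/-- A vector field whose inner products with smooth vector fields are smooth is smooth. -/
theorem contMDiffAt_of_contMDiffAt_inner
    (h : ∀ Z : ∀ p : N, TangentSpace 𝓘(ℝ, E) p,
      (∀ᶠ q in 𝓝 p, CMDiffAt ∞ (T% Z) q) → CMDiffAt ∞ (fun q ↦ (inner ℝ (W q) (Z q) : ℝ)) p) :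
    CMDiffAt ∞ (T% W) p := by
  classical
  set e := trivializationAt E (fun p : N ↦ TangentSpace 𝓘(ℝ, E) p) p with he
  have hp : p ∈ e.baseSet := FiberBundle.mem_baseSet_trivializationAt' p
  set b := Module.finBasis ℝ E
  set s := e.localFrame b with hs
  have hs_smooth : ∀ i, ∀ᶠ q in 𝓝 p, CMDiffAt ∞ (T% (s i)) q := fun i ↦ by
    filter_upwards [e.open_baseSet.mem_nhds hp] with q hq
    exact contMDiffAt_localFrame_of_mem _ _ _ _ hq
  rw [contMDiffAt_iff_localFrameCoeff (e := e) b hp]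
  intro i
  set G : N → Matrix (Fin (Module.finrank ℝ E)) (Fin (Module.finrank ℝ E)) ℝ :=
    fun q ↦ Matrix.gram ℝ (fun i ↦ s i q) with hG
  have hG_smooth : ∀ i j, CMDiffAt ∞ (fun q ↦ G q i j) p := fun i j ↦
    contMDiffAt_inner (hs_smooth i).self_of_nhds (hs_smooth j).self_of_nhds
  have hdet : ∀ q ∈ e.baseSet, (G q).det ≠ 0 := fun q hq ↦ by
    rw [hG, Matrix.det_gram_ne_zero_iff_linearIndependent]
    simp only [hs, Bundle.Trivialization.localFrame_apply_of_mem_baseSet e b hq]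
    exact (e.basisAt b hq).linearIndependent
  -- The frame coefficients of `W` solve a linear system with the Gram matrix of the frame and
  -- right-hand side `⟨W, s j⟩`; Cramer's rule writes them as quotients of determinants with smooth
  -- entries.
  have hcramer : ∀ q ∈ e.baseSet, (LinearMap.piApply (e.localFrameCoeff 𝓘(ℝ, E) b i)) W q
      = ((G q).det)⁻¹ * ((G q).updateCol i (fun j ↦ inner ℝ (W q) (s j q))).det := by
    intro q hq
    set c := fun i ↦ e.localFrameCoeff 𝓘(ℝ, E) b i q (W q) with hc
    have hsum : W q = ∑ j, c j • s j q := e.eq_sum_localFrameCoeff_smul hq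
    have hmul : (fun j ↦ (inner ℝ (W q) (s j q) : ℝ)) = (G q).mulVec c := by
      funext j
      conv_lhs => rw [hsum]
      simp only [sum_inner, inner_smul_left, Matrix.mulVec, dotProduct, hG, Matrix.gram_apply]
      exact Finset.sum_congr rfl fun k _ ↦ by rw [real_inner_comm]; simp [mul_comm]
    rw [← Matrix.cramer_apply, Matrix.cramer_eq_adjugate_mulVec, hmul, Matrix.mulVec_mulVec,
      Matrix.adjugate_mul, Matrix.smul_mulVec, Matrix.one_mulVec]
    simp [hdet q hq, hc]
  refine ContMDiffAt.congr_of_eventuallyEq ?_ (eventually_of_mem (e.open_baseSet.mem_nhds hp)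
    hcramer)
  refine ((contMDiffAt_det hG_smooth).inv₀ (hdet p hp)).mul (contMDiffAt_det fun k l ↦ ?_)
  by_cases hl : l = i
  · simpa [hl] using h _ (hs_smooth k)
  · simpa [Matrix.updateCol_ne hl] using hG_smooth k l

theorem contMDiffAt_covDeriv (hX : ∀ᶠ q in 𝓝 p, CMDiffAt ∞ (T% X) q)
    (hY : ∀ᶠ q in 𝓝 p, CMDiffAt ∞ (T% Y) q) :
    CMDiffAt ∞ (T% (fun q ↦ covDeriv Y q (X q))) p := by
  refine contMDiffAt_of_contMDiffAt_inner fun Z hZ ↦ ?_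
  have hX' := hX.self_of_nhds
  have hY' := hY.self_of_nhds
  have hZ' := hZ.self_of_nhds
  have key : CMDiffAt ∞ (fun q ↦ (1 / 2 : ℝ) * koszul X Y Z q) p := by
    refine contMDiffAt_const.mul ?_
    refine (((((contMDiffAt_mvfderiv_apply (contMDiffAt_inner hY' hZ') hX').add
      (contMDiffAt_mvfderiv_apply (contMDiffAt_inner hZ' hX') hY')).sub
      (contMDiffAt_mvfderiv_apply (contMDiffAt_inner hX' hY') hZ')).add
      (contMDiffAt_inner (contMDiffAt_mlieBracket hX' hY') hZ')).sub
      (contMDiffAt_inner (contMDiffAt_mlieBracket hY' hZ') hX')).add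
      (contMDiffAt_inner (contMDiffAt_mlieBracket hZ' hX') hY')
  refine key.congr_of_eventuallyEq ?_
  filter_upwards [hX, hY, hZ] with q h1 h2 h3
  rw [← two_mul_inner_covDeriv (h1.mdifferentiableAt (by simp)) (h2.mdifferentiableAt (by simp))
    (h3.mdifferentiableAt (by simp))]
  ring

theorem inner_grad (f : N → ℝ) (p : N) (v : TangentSpace 𝓘(ℝ, E) p) :
    inner ℝ (grad E f p) v = mvfderiv 𝓘(ℝ, E) f p v := by
  simp [grad]

theorem contMDiffAt_grad {f : N → ℝ} (hf : ContMDiffAt 𝓘(ℝ, E) 𝓘(ℝ, ℝ) ∞ f p) :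
    CMDiffAt ∞ (T% (grad E f)) p := by
  refine contMDiffAt_of_contMDiffAt_inner fun Z hZ ↦ ?_
  simp only [inner_grad]
  exact contMDiffAt_mvfderiv_apply hf hZ.self_of_nhds

/-- The antisymmetric part is `X Y f - Y X f` minus the derivative of `f` along `∇_X Y - ∇_Y X`; the
latter field is `[X, Y]`, so the difference vanishes. -/
theorem hessian_symm {f : N → ℝ} (hf : ∀ᶠ q in 𝓝 p, ContMDiffAt 𝓘(ℝ, E) 𝓘(ℝ, ℝ) ∞ f q)
    (v w : TangentSpace 𝓘(ℝ, E) p) : hessian f p v w = hessian f p w v := by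
  have hX := eventually_contMDiffAt_extend v
  have hY := eventually_contMDiffAt_extend w
  have hn := (contMDiffAt_grad hf.self_of_nhds).mdifferentiableAt (by simp)
  have hX' := hX.self_of_nhds.mdifferentiableAt (n := ∞) (by simp)
  have hY' := hY.self_of_nhds.mdifferentiableAt (n := ∞) (by simp)
  have h1 := mvfderiv_inner_apply hn hY' v
  have h2 := mvfderiv_inner_apply hn hX' w
  have h3 := mvfderiv_mlieBracket_apply hf hX hY
  rw [← covDeriv_sub_covDeriv hX' hY', ← inner_grad] at h3
  simp only [inner_grad, FiberBundle.extend_apply_self, inner_sub_right] at h1 h2 h3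
  simp only [hessian]
  linarith

end Smoothness

/-! ### Tensoriality of the curvature and the Riccati equation -/

section Curvature

open Filter VectorField

variable {E : Type*} [NormedAddCommGroup E] [NormedSpace ℝ E] [FiniteDimensional ℝ E]
  {N : Type*} [TopologicalSpace N] [ChartedSpace E N] [IsManifold 𝓘(ℝ, E) ∞ N]
  [RiemannianBundle (fun p : N ↦ TangentSpace 𝓘(ℝ, E) p)]
  [IsContMDiffRiemannianBundle 𝓘(ℝ, E) ∞ E (fun p : N ↦ TangentSpace 𝓘(ℝ, E) p)]
  {X Y Z W : ∀ p : N, TangentSpace 𝓘(ℝ, E) p} {p : N}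

theorem mvfderiv_mvfderiv_inner_apply (hX : ∀ᶠ q in 𝓝 p, CMDiffAt ∞ (T% X) q)
    (hZ : ∀ᶠ q in 𝓝 p, CMDiffAt ∞ (T% Z) q)
    (hW : ∀ᶠ q in 𝓝 p, CMDiffAt ∞ (T% W) q) (v : TangentSpace 𝓘(ℝ, E) p) :
    mvfderiv 𝓘(ℝ, E) (fun q ↦ mvfderiv 𝓘(ℝ, E) (fun q ↦ inner ℝ (Z q) (W q)) q (X q)) p v
      = inner ℝ (covDeriv (fun q ↦ covDeriv Z q (X q)) p v) (W p)
        + inner ℝ (covDeriv Z p (X p)) (covDeriv W p v)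
        + (inner ℝ (covDeriv Z p v) (covDeriv W p (X p))
        + inner ℝ (Z p) (covDeriv (fun q ↦ covDeriv W q (X q)) p v)) := by
  have h : (fun q ↦ mvfderiv 𝓘(ℝ, E) (fun q ↦ inner ℝ (Z q) (W q)) q (X q)) =ᶠ[𝓝 p]
      fun q ↦ inner ℝ (covDeriv Z q (X q)) (W q) + inner ℝ (Z q) (covDeriv W q (X q)) := by
    filter_upwards [hZ, hW] with q h1 h2
    exact mvfderiv_inner_apply (h1.mdifferentiableAt (by simp)) (h2.mdifferentiableAt (by simp)) _
  have dZ := hZ.self_of_nhds.mdifferentiableAt (n := ∞) (by simp)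
  have dW := hW.self_of_nhds.mdifferentiableAt (n := ∞) (by simp)
  have dXZ := (contMDiffAt_covDeriv hX hZ).mdifferentiableAt (by simp)
  have dXW := (contMDiffAt_covDeriv hX hW).mdifferentiableAt (by simp)
  rw [mvfderiv_congr_of_eventuallyEq h, mvfderiv_fun_add (mdifferentiableAt_inner dXZ dW)
    (mdifferentiableAt_inner dZ dXW), _root_.add_apply, mvfderiv_inner_apply dXZ dW,
    mvfderiv_inner_apply dZ dXW]

/-- The curvature operator `R(X, Y)` is skew-adjoint. -/
theorem inner_riemannCurv_left (hX : ∀ᶠ q in 𝓝 p, CMDiffAt ∞ (T% X) q)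
    (hY : ∀ᶠ q in 𝓝 p, CMDiffAt ∞ (T% Y) q) (hZ : ∀ᶠ q in 𝓝 p, CMDiffAt ∞ (T% Z) q)
    (hW : ∀ᶠ q in 𝓝 p, CMDiffAt ∞ (T% W) q) :
    inner ℝ (riemannCurv X Y Z p) (W p) = -inner ℝ (Z p) (riemannCurv X Y W p) := by
  have h1 := mvfderiv_mvfderiv_inner_apply hY hZ hW (X p)
  have h2 := mvfderiv_mvfderiv_inner_apply hX hZ hW (Y p)
  have h3 := mvfderiv_inner_apply (hZ.self_of_nhds.mdifferentiableAt (n := ∞) (by simp))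
    (hW.self_of_nhds.mdifferentiableAt (n := ∞) (by simp)) (mlieBracket 𝓘(ℝ, E) X Y p)
  have h4 := mvfderiv_mlieBracket_apply
    (by filter_upwards [hZ, hW] with q h1 h2 using contMDiffAt_inner h1 h2) hX hY
  simp only [riemannCurv, inner_sub_left, inner_sub_right]
  linarith

theorem riemannCurv_sub (hX : ∀ᶠ q in 𝓝 p, CMDiffAt ∞ (T% X) q)
    (hY : ∀ᶠ q in 𝓝 p, CMDiffAt ∞ (T% Y) q) (hZ : ∀ᶠ q in 𝓝 p, CMDiffAt ∞ (T% Z) q)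
    (hW : ∀ᶠ q in 𝓝 p, CMDiffAt ∞ (T% W) q) :
    riemannCurv X Y (Z - W) p = riemannCurv X Y Z p - riemannCurv X Y W p := by
  have key : ∀ {V U : ∀ p : N, TangentSpace 𝓘(ℝ, E) p}, (∀ᶠ q in 𝓝 p, CMDiffAt ∞ (T% V) q) →
      (∀ᶠ q in 𝓝 p, CMDiffAt ∞ (T% U) q) →
      covDeriv (fun q ↦ covDeriv (Z - W) q (V q)) p (U p)
        = covDeriv (fun q ↦ covDeriv Z q (V q)) p (U p)
          - covDeriv (fun q ↦ covDeriv W q (V q)) p (U p) := by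
    intro V U hV hU
    have d1 := (contMDiffAt_covDeriv hV hZ).mdifferentiableAt (by simp)
    have d2 := (contMDiffAt_covDeriv hV hW).mdifferentiableAt (by simp)
    rw [← covDeriv_sub d1 d2]
    symm
    refine covDeriv_congr (mdifferentiableAt_sub_section d1 d2) ?_ _
    filter_upwards [hZ, hW] with q h1 h2
    exact (covDeriv_sub (h1.mdifferentiableAt (by simp)) (h2.mdifferentiableAt (by simp)) _).symm
  simp only [riemannCurv]
  rw [key hY hX, key hX hY, covDeriv_sub (hZ.self_of_nhds.mdifferentiableAt (n := ∞) (by simp))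
    (hW.self_of_nhds.mdifferentiableAt (n := ∞) (by simp))]
  abel

/-- `R(X, Y) Z` at `p` depends on `Z` only through its value at `p`. -/
theorem riemannCurv_congr (hX : ∀ᶠ q in 𝓝 p, CMDiffAt ∞ (T% X) q)
    (hY : ∀ᶠ q in 𝓝 p, CMDiffAt ∞ (T% Y) q) (hZ : ∀ᶠ q in 𝓝 p, CMDiffAt ∞ (T% Z) q)
    (hW : ∀ᶠ q in 𝓝 p, CMDiffAt ∞ (T% W) q) (h : Z p = W p) :
    riemannCurv X Y Z p = riemannCurv X Y W p := by
  rw [← sub_eq_zero, ← riemannCurv_sub hX hY hZ hW]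
  refine ext_inner_right ℝ fun u ↦ ?_
  have hZW : ∀ᶠ q in 𝓝 p, CMDiffAt ∞ (T% (Z - W)) q := by
    filter_upwards [hZ, hW] with q h1 h2 using h1.sub_section h2
  -- Skew-adjointness moves the operator off `Z - W`, so that only the value of `Z - W` at `p`
  -- enters, and this is zero.
  have := inner_riemannCurv_left hX hY hZW (eventually_contMDiffAt_extend u)
  simpa [h] using this

theorem eventually_contMDiffAt_grad {f : N → ℝ}
    (hf : ∀ᶠ q in 𝓝 p, ContMDiffAt 𝓘(ℝ, E) 𝓘(ℝ, ℝ) ∞ f q) :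
    ∀ᶠ q in 𝓝 p, CMDiffAt ∞ (T% (grad E f)) q :=
  hf.mono fun _ h ↦ contMDiffAt_grad h

/-- Differentiate `⟨grad f, grad f⟩ = 1`. -/
theorem hessian_grad_right_eq_zero {f : N → ℝ}
    (hf : ContMDiffAt 𝓘(ℝ, E) 𝓘(ℝ, ℝ) ∞ f p)
    (hunit : ∀ᶠ q in 𝓝 p, ‖grad E f q‖ = 1) (v : TangentSpace 𝓘(ℝ, E) p) :
    hessian f p v (grad E f p) = 0 := by
  have hn := (contMDiffAt_grad hf).mdifferentiableAt (by simp)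
  have h1 := mvfderiv_inner_apply hn hn v
  have h2 : (fun q ↦ (inner ℝ (grad E f q) (grad E f q) : ℝ)) =ᶠ[𝓝 p] fun _ ↦ 1 := by
    filter_upwards [hunit] with q hq
    rw [real_inner_self_eq_norm_sq, hq, one_pow]
  rw [mvfderiv_congr_of_eventuallyEq h2, mvfderiv_const,
    real_inner_comm (covDeriv (grad E f) p v)] at h1
  simp only [_root_.zero_apply] at h1
  rw [hessian]
  linarith

/-- The Riccati equation for the Hessian of a function whose gradient has norm one. -/
theorem mvfderiv_hessian_grad {f : N → ℝ}
    (hf : ∀ᶠ q in 𝓝 p, ContMDiffAt 𝓘(ℝ, E) 𝓘(ℝ, ℝ) ∞ f q)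
    (hunit : ∀ᶠ q in 𝓝 p, ‖grad E f q‖ = 1) (v : TangentSpace 𝓘(ℝ, E) p) :
    mvfderiv 𝓘(ℝ, E) (fun q ↦ hessian f q (FiberBundle.extend E v q) (FiberBundle.extend E v q))
        p (grad E f p)
      = -inner ℝ (riemannCurv (FiberBundle.extend E v) (FiberBundle.extend E (grad E f p))
          (FiberBundle.extend E (grad E f p)) p) v
        - ‖covDeriv (grad E f) p v‖ ^ 2
        + 2 * inner ℝ (covDeriv (grad E f) p v)
            (covDeriv (FiberBundle.extend E v) p (grad E f p)) := by
  set X := FiberBundle.extend E v with hXdef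
  set Y := FiberBundle.extend E (grad E f p) with hYdef
  set n := grad E f with hndef
  have hXp : X p = v := by simp [X]
  have hYp : Y p = n p := by simp [Y, n]
  have hX : ∀ᶠ q in 𝓝 p, CMDiffAt ∞ (T% X) q := eventually_contMDiffAt_extend v
  have hY : ∀ᶠ q in 𝓝 p, CMDiffAt ∞ (T% Y) q := eventually_contMDiffAt_extend _
  have hn : ∀ᶠ q in 𝓝 p, CMDiffAt ∞ (T% n) q := eventually_contMDiffAt_grad hf
  have dX := hX.self_of_nhds.mdifferentiableAt (n := ∞) (by simp)
  have dY := hY.self_of_nhds.mdifferentiableAt (n := ∞) (by simp)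
  have dn := hn.self_of_nhds.mdifferentiableAt (n := ∞) (by simp)
  have dSX := (contMDiffAt_covDeriv hX hn).mdifferentiableAt (by simp)
  have dSY := (contMDiffAt_covDeriv hY hn).mdifferentiableAt (by simp)
  have symm : ∀ᶠ q in 𝓝 p, ∀ u w : TangentSpace 𝓘(ℝ, E) q,
      (inner ℝ (covDeriv n q u) w : ℝ) = inner ℝ u (covDeriv n q w) := by
    filter_upwards [hf.eventually_nhds] with q hq u w
    exact (hessian_symm hq u w).trans (real_inner_comm _ _)
  have perp : ∀ᶠ q in 𝓝 p, ∀ u : TangentSpace 𝓘(ℝ, E) q,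
      (inner ℝ (n q) (covDeriv n q u) : ℝ) = 0 := by
    filter_upwards [hf, hunit.eventually_nhds] with q h1 h2 u
    rw [real_inner_comm]
    exact hessian_grad_right_eq_zero h1 h2 u
  have Sn : covDeriv n p (n p) = 0 := by
    refine ext_inner_right ℝ fun u ↦ ?_
    rw [symm.self_of_nhds, perp.self_of_nhds, inner_zero_left]
  -- In the last slot the extension of `n p` may be replaced by the gradient field `n` itself, which
  -- brings in `S = ∇n`; the other two slots keep their extensions.
  rw [riemannCurv_congr hX hY hY hn hYp]
  -- Since `S` is symmetric and its image is orthogonal to `n`, `m1`, `m2`, `m3` give `⟨∇_v (S Y),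
  -- v⟩ = ⟨∇_v Y, S v⟩ - ‖S v‖²`. The first term cancels against the `∇_X Y` part of the bracket
  -- term in the curvature.
  have m1 := mvfderiv_inner_apply dSY dX v
  have m2 := mvfderiv_inner_apply dY dSX v
  have m3 := mvfderiv_inner_apply dn dSX v
  have m4 := mvfderiv_inner_apply dSX dX (n p)
  have e1 : (fun q ↦ (inner ℝ (covDeriv n q (Y q)) (X q) : ℝ)) =ᶠ[𝓝 p]
      fun q ↦ inner ℝ (Y q) (covDeriv n q (X q)) := symm.mono fun q hq ↦ hq _ _
  have e2 : (fun q ↦ (inner ℝ (n q) (covDeriv n q (X q)) : ℝ)) =ᶠ[𝓝 p]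
      fun _ ↦ 0 := perp.mono fun q hq ↦ hq _
  rw [mvfderiv_congr_of_eventuallyEq e1] at m1
  rw [mvfderiv_congr_of_eventuallyEq e2, mvfderiv_const] at m3
  have hbr := covDeriv_sub_covDeriv dX dY
  simp only [riemannCurv, hessian, ← hbr, inner_sub_left]
  rw [covDeriv_sub_right dn, inner_sub_left, symm.self_of_nhds, symm.self_of_nhds]
  simp only [hXp, hYp, Sn, inner_zero_left, _root_.zero_apply] at *
  rw [real_inner_self_eq_norm_sq] at m3
  rw [real_inner_comm (covDeriv n p v) (covDeriv X p (n p))]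
  linarith

end Curvature

/-! ### First-touching argument for the Riccati equation -/

section RiccatiComparison

open Filter VectorField

/-- With `b = Q(v, u)` and `c = Q(u, u)`, this says that a null vector `v` of a negative
semidefinite form `Q` lies in its radical. -/
theorem eq_zero_of_forall_two_mul_add_sq_mul_nonpos {b c : ℝ}
    (h : ∀ r : ℝ, 2 * r * b + r ^ 2 * c ≤ 0) : b = 0 := by
  have hc : c ≤ 0 := by nlinarith [h 1, h (-1)]
  have h1 : (0 : ℝ) < 1 - c := by linarith
  -- For `r = b / (1 - c)` the expression equals `r² (2 - c)`, with `2 - c > 0`.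
  have h2 := h (b / (1 - c))
  have h3 : 2 * (b / (1 - c)) * b + (b / (1 - c)) ^ 2 * c
      = (b / (1 - c)) ^ 2 * (2 - c) := by
    field_simp
    ring
  rw [h3] at h2
  have h4 : (b / (1 - c)) ^ 2 ≤ 0 := by nlinarith
  have h5 : b / (1 - c) = 0 := pow_eq_zero_iff two_ne_zero |>.1 (le_antisymm h4 (sq_nonneg _))
  exact (div_eq_zero_iff.1 h5).resolve_right h1.ne'

/-- Negative definiteness of a quadratic form is an open condition on its matrix. -/
theorem eventually_forall_sum_neg {m : ℕ} {A₀ : Fin m → Fin m → ℝ}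
    (h : ∀ c : Fin m → ℝ, c ≠ 0 → ∑ i, ∑ j, c i * c j * A₀ i j < 0) :
    ∀ᶠ A in 𝓝 A₀, ∀ c : Fin m → ℝ, c ≠ 0 → ∑ i, ∑ j, c i * c j * A i j < 0 := by
  -- By homogeneity the unit sphere suffices, and its compactness makes the neighbourhood of `A₀`
  -- uniform in `c`.
  have key : ∀ᶠ A in 𝓝 A₀, ∀ c ∈ Metric.sphere (0 : Fin m → ℝ) 1,
      ∑ i, ∑ j, c i * c j * A i j < 0 := by
    refine (isCompact_sphere _ _).eventually_forall_of_forall_eventually fun c hc ↦ ?_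
    have hcont : Continuous fun z : (Fin m → Fin m → ℝ) × (Fin m → ℝ) ↦
        ∑ i, ∑ j, z.2 i * z.2 j * z.1 i j := by fun_prop
    exact hcont.continuousAt.eventually_lt_const (h c (ne_zero_of_mem_unit_sphere ⟨c, hc⟩))
  filter_upwards [key] with A hA c hc
  have hnorm : 0 < ‖c‖ := norm_pos_iff.2 hc
  have h1 := hA (‖c‖⁻¹ • c) (by simp [norm_smul, hnorm.ne'])
  have h2 : ∑ i, ∑ j, c i * c j * A i j
      = ‖c‖ ^ 2 * ∑ i, ∑ j, (‖c‖⁻¹ • c) i * (‖c‖⁻¹ • c) j * A i j := by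
    simp only [Finset.mul_sum, Pi.smul_apply, smul_eq_mul]
    refine Finset.sum_congr rfl fun i _ ↦ Finset.sum_congr rfl fun j _ ↦ ?_
    field_simp
  rw [h2]
  exact mul_neg_of_pos_of_neg (by positivity) h1

variable {E : Type*} [NormedAddCommGroup E] [NormedSpace ℝ E] [FiniteDimensional ℝ E]
  {N : Type*} [TopologicalSpace N] [ChartedSpace E N] [IsManifold 𝓘(ℝ, E) ∞ N]
  [RiemannianBundle (fun p : N ↦ TangentSpace 𝓘(ℝ, E) p)]

/-- The bilinear form `σ (∇²f - c (g - n ⊗ n)) - n ⊗ n`, where `n` is the gradient of `f`. -/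
def riccatiForm (σ : ℝ) (f : N → ℝ) (c : ℝ) (p : N) (u w : TangentSpace 𝓘(ℝ, E) p) : ℝ :=
  σ * hessian f p u w
    - σ * c * (inner ℝ u w - inner ℝ u (grad E f p) * inner ℝ w (grad E f p))
    - inner ℝ u (grad E f p) * inner ℝ w (grad E f p)

variable [IsContMDiffRiemannianBundle 𝓘(ℝ, E) ∞ E (fun p : N ↦ TangentSpace 𝓘(ℝ, E) p)]
  {X Y : ∀ p : N, TangentSpace 𝓘(ℝ, E) p} {p : N} {f : N → ℝ} {σ c : ℝ}

theorem hessian_add_left (hf : ContMDiffAt 𝓘(ℝ, E) 𝓘(ℝ, ℝ) ∞ f p)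
    (u v w : TangentSpace 𝓘(ℝ, E) p) :
    hessian f p (u + v) w = hessian f p u w + hessian f p v w := by
  rw [hessian, covDeriv_add_right ((contMDiffAt_grad hf).mdifferentiableAt (by simp)),
    inner_add_left]
  rfl

theorem hessian_smul_left (hf : ContMDiffAt 𝓘(ℝ, E) 𝓘(ℝ, ℝ) ∞ f p) (r : ℝ)
    (u w : TangentSpace 𝓘(ℝ, E) p) :
    hessian f p (r • u) w = r * hessian f p u w := by
  rw [hessian, covDeriv_smul_right ((contMDiffAt_grad hf).mdifferentiableAt (by simp)),
    inner_smul_left]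
  rfl

theorem hessian_add_right (u v w : TangentSpace 𝓘(ℝ, E) p) :
    hessian f p u (v + w) = hessian f p u v + hessian f p u w :=
  inner_add_right _ _ _

theorem hessian_smul_right (r : ℝ) (u w : TangentSpace 𝓘(ℝ, E) p) :
    hessian f p u (r • w) = r * hessian f p u w :=
  inner_smul_right _ _ _

theorem riccatiForm_add_left (hf : ContMDiffAt 𝓘(ℝ, E) 𝓘(ℝ, ℝ) ∞ f p)
    (u v w : TangentSpace 𝓘(ℝ, E) p) :
    riccatiForm σ f c p (u + v) w = riccatiForm σ f c p u w + riccatiForm σ f c p v w := by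
  simp only [riccatiForm, hessian_add_left hf, inner_add_left]
  ring

theorem riccatiForm_smul_left (hf : ContMDiffAt 𝓘(ℝ, E) 𝓘(ℝ, ℝ) ∞ f p) (r : ℝ)
    (u w : TangentSpace 𝓘(ℝ, E) p) :
    riccatiForm σ f c p (r • u) w = r * riccatiForm σ f c p u w := by
  simp only [riccatiForm, hessian_smul_left hf, real_inner_smul_left]
  ring

theorem riccatiForm_symm (hf : ∀ᶠ q in 𝓝 p, ContMDiffAt 𝓘(ℝ, E) 𝓘(ℝ, ℝ) ∞ f q)
    (u w : TangentSpace 𝓘(ℝ, E) p) :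
    riccatiForm σ f c p u w = riccatiForm σ f c p w u := by
  simp only [riccatiForm, hessian_symm hf u w, real_inner_comm u w]
  ring

theorem riccatiForm_sum_sum (hf : ∀ᶠ q in 𝓝 p, ContMDiffAt 𝓘(ℝ, E) 𝓘(ℝ, ℝ) ∞ f q)
    {m : ℕ} (a : Fin m → ℝ) (s : Fin m → TangentSpace 𝓘(ℝ, E) p) :
    riccatiForm σ f c p (∑ i, a i • s i) (∑ i, a i • s i)
      = ∑ i, ∑ j, a i * a j * riccatiForm σ f c p (s i) (s j) := by
  let B : TangentSpace 𝓘(ℝ, E) p →ₗ[ℝ] TangentSpace 𝓘(ℝ, E) p →ₗ[ℝ] ℝ :=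
    LinearMap.mk₂ ℝ (riccatiForm σ f c p) (riccatiForm_add_left hf.self_of_nhds)
      (riccatiForm_smul_left hf.self_of_nhds)
      (fun u v w ↦ by
        rw [riccatiForm_symm hf, riccatiForm_add_left hf.self_of_nhds, riccatiForm_symm hf,
          riccatiForm_symm hf w])
      (fun r u v ↦ by
        rw [riccatiForm_symm hf, riccatiForm_smul_left hf.self_of_nhds, riccatiForm_symm hf]; rfl)
  have : ∀ u w, riccatiForm σ f c p u w = B u w := fun u w ↦ rfl
  simp only [this, map_sum, LinearMap.sum_apply, map_smul, LinearMap.smul_apply, smul_eq_mul,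
    Finset.mul_sum, mul_assoc]
  rw [Finset.sum_comm]
  refine Finset.sum_congr rfl fun i _ ↦ Finset.sum_congr rfl fun j _ ↦ ?_
  ring

theorem mdifferentiableAt_hessian (hf : ∀ᶠ q in 𝓝 p, ContMDiffAt 𝓘(ℝ, E) 𝓘(ℝ, ℝ) ∞ f q)
    (hX : ∀ᶠ q in 𝓝 p, CMDiffAt ∞ (T% X) q) (hY : ∀ᶠ q in 𝓝 p, CMDiffAt ∞ (T% Y) q) :
    MDiffAt (fun q ↦ hessian f q (X q) (Y q)) p :=
  mdifferentiableAt_inner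
    ((contMDiffAt_covDeriv hX (eventually_contMDiffAt_grad hf)).mdifferentiableAt (by simp))
    (hY.self_of_nhds.mdifferentiableAt (n := ∞) (by simp))

theorem continuousWithinAt_riccatiForm {γ : ℝ → N} {ψ : ℝ → ℝ} {s : Set ℝ} {t : ℝ}
    (hf : ∀ᶠ q in 𝓝 (γ t), ContMDiffAt 𝓘(ℝ, E) 𝓘(ℝ, ℝ) ∞ f q)
    (hX : ∀ᶠ q in 𝓝 (γ t), CMDiffAt ∞ (T% X) q) (hY : ∀ᶠ q in 𝓝 (γ t), CMDiffAt ∞ (T% Y) q)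
    (hγ : ContinuousWithinAt γ s t) (hψ : ContinuousWithinAt ψ s t) :
    ContinuousWithinAt (fun r ↦ riccatiForm σ f (ψ r) (γ r) (X (γ r)) (Y (γ r))) s t := by
  have dX := hX.self_of_nhds.mdifferentiableAt (n := ∞) (by simp)
  have dY := hY.self_of_nhds.mdifferentiableAt (n := ∞) (by simp)
  have dn := (contMDiffAt_grad hf.self_of_nhds).mdifferentiableAt (by simp)
  have c1 := (mdifferentiableAt_hessian hf hX hY).continuousAt.comp_continuousWithinAt hγ
  have c2 := (mdifferentiableAt_inner dX dY).continuousAt.comp_continuousWithinAt hγ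
  have c3 := (mdifferentiableAt_inner dX dn).continuousAt.comp_continuousWithinAt hγ
  have c4 := (mdifferentiableAt_inner dY dn).continuousAt.comp_continuousWithinAt hγ
  exact ((continuousWithinAt_const.mul c1).sub
    ((continuousWithinAt_const.mul hψ).mul (c2.sub (c3.mul c4)))).sub (c3.mul c4)

/-- The form lives on a varying tangent space; in a local frame it becomes a matrix depending
continuously on the time, for which negative definiteness is open. -/
theorem eventually_riccatiForm_neg {γ : ℝ → N} {ψ : ℝ → ℝ} {s : Set ℝ} {t : ℝ}
    (hf : ∀ᶠ q in 𝓝 (γ t), ContMDiffAt 𝓘(ℝ, E) 𝓘(ℝ, ℝ) ∞ f q)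
    (hγ : ContinuousWithinAt γ s t) (hψ : ContinuousWithinAt ψ s t)
    (h : ∀ u : TangentSpace 𝓘(ℝ, E) (γ t), u ≠ 0 →
      riccatiForm σ f (ψ t) (γ t) u u < 0) :
    ∀ᶠ r in 𝓝[s] t, ∀ u : TangentSpace 𝓘(ℝ, E) (γ r), u ≠ 0 →
      riccatiForm σ f (ψ r) (γ r) u u < 0 := by
  set e := trivializationAt E (fun p : N ↦ TangentSpace 𝓘(ℝ, E) p) (γ t) with he
  have ht : γ t ∈ e.baseSet := FiberBundle.mem_baseSet_trivializationAt' (γ t)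
  have hbase := e.open_baseSet.mem_nhds ht
  set b := Module.finBasis ℝ E
  set S := e.localFrame b with hS
  have hS_smooth : ∀ i, ∀ᶠ q in 𝓝 (γ t), CMDiffAt ∞ (T% (S i)) q := fun i ↦ by
    filter_upwards [hbase] with q hq
    exact contMDiffAt_localFrame_of_mem _ _ _ _ hq
  have hSb : ∀ {q} (hq : q ∈ e.baseSet) i, S i q = e.basisAt b hq i := fun hq i ↦
    Bundle.Trivialization.localFrame_apply_of_mem_baseSet e b hq
  set A : ℝ → Fin (Module.finrank ℝ E) → Fin (Module.finrank ℝ E) → ℝ :=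
    fun r i j ↦ riccatiForm σ f (ψ r) (γ r) (S i (γ r)) (S j (γ r)) with hA
  have hAcont : ContinuousWithinAt A s t := by
    refine continuousWithinAt_pi.2 fun i ↦ continuousWithinAt_pi.2 fun j ↦ ?_
    exact continuousWithinAt_riccatiForm hf (hS_smooth i) (hS_smooth j) hγ hψ
  have hneg : ∀ a : Fin (Module.finrank ℝ E) → ℝ, a ≠ 0 →
      ∑ i, ∑ j, a i * a j * A t i j < 0 := by
    intro a ha
    rw [hA, ← riccatiForm_sum_sum hf]
    refine h _ fun h0 ↦ ha ?_
    simp only [hSb ht] at h0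
    exact funext fun i ↦ Fintype.linearIndependent_iff.1
      (e.basisAt b ht).linearIndependent a h0 i
  filter_upwards [hAcont.eventually (eventually_forall_sum_neg hneg), hγ.eventually hbase,
    hγ.eventually hf.eventually_nhds] with r h1 h2 h3 u hu
  have hu' : u = ∑ i, (e.basisAt b h2).repr u i • S i (γ r) := by
    simp only [hSb h2]
    exact ((e.basisAt b h2).sum_repr u).symm
  rw [hu', riccatiForm_sum_sum h3]
  refine h1 _ fun h0 ↦ hu ?_
  exact (e.basisAt b h2).repr.map_eq_zero_iff.1 (DFunLike.coe_injective h0)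

theorem hasDerivAt_comp_curve {g : N → ℝ} {γ : ℝ → N} {t : ℝ} {v : TangentSpace 𝓘(ℝ, E) (γ t)}
    (hg : MDiffAt g (γ t)) (hγ : MDifferentiableAt 𝓘(ℝ, ℝ) 𝓘(ℝ, E) γ t)
    (hv : mfderiv 𝓘(ℝ, ℝ) 𝓘(ℝ, E) γ t (1 : ℝ) = v) :
    HasDerivAt (fun s ↦ g (γ s)) (mvfderiv 𝓘(ℝ, E) g (γ t) v) t := by
  have h : HasFDerivAt (fun s ↦ g (γ s)) ((mvfderiv 𝓘(ℝ, E) g (γ t)).comp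
      (mfderiv 𝓘(ℝ, ℝ) 𝓘(ℝ, E) γ t) : ℝ →L[ℝ] ℝ) t :=
    (hg.hasMFDerivAt.comp t hγ.hasMFDerivAt).hasFDerivAt
  have h' := h.hasDerivAt
  rw [← hv]
  exact h'

/-- Riccati comparison: negative definiteness of the form persists along an integral curve of
the gradient if `ψ` is a strict super- or subsolution of the scalar Riccati equation. -/
theorem riccatiForm_neg_of_riccati {γ : ℝ → N} {ψ ψ' : ℝ → ℝ} {d : ℝ} (hσ : σ = 1 ∨ σ = -1)
    (hf : ∀ t ∈ Ico 0 d, ∀ᶠ q in 𝓝 (γ t), ContMDiffAt 𝓘(ℝ, E) 𝓘(ℝ, ℝ) ∞ f q)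
    (hγ : ContinuousOn γ (Ico 0 d))
    (hγd : ∀ t ∈ Ioo 0 d, MDifferentiableAt 𝓘(ℝ, ℝ) 𝓘(ℝ, E) γ t)
    (hγ' : ∀ t ∈ Ioo 0 d, mfderiv 𝓘(ℝ, ℝ) 𝓘(ℝ, E) γ t (1 : ℝ) = grad E f (γ t))
    (hunit : ∀ t ∈ Ioo 0 d, ∀ᶠ q in 𝓝 (γ t), ‖grad E f q‖ = 1)
    (hψ : ContinuousOn ψ (Ico 0 d)) (hψd : ∀ t ∈ Ioo 0 d, HasDerivAt ψ (ψ' t) t)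
    (h0 : ∀ u : TangentSpace 𝓘(ℝ, E) (γ 0), u ≠ 0 →
      riccatiForm σ f (ψ 0) (γ 0) u u < 0)
    (hK : ∀ t ∈ Ioo 0 d, ∀ v : TangentSpace 𝓘(ℝ, E) (γ t), ‖v‖ = 1 →
      inner ℝ v (grad E f (γ t)) = 0 →
      σ * (-sectionalCurv (γ t) v (grad E f (γ t)) - ψ t ^ 2 - ψ' t) < 0) :
    ∀ t ∈ Ico 0 d, ∀ u : TangentSpace 𝓘(ℝ, E) (γ t), u ≠ 0 →
      riccatiForm σ f (ψ t) (γ t) u u < 0 := by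
  have step : ∀ t ∈ Ioo 0 d, (∀ s ∈ Ico 0 t, ∀ u : TangentSpace 𝓘(ℝ, E) (γ s), u ≠ 0 →
      riccatiForm σ f (ψ s) (γ s) u u < 0) →
      ∀ u : TangentSpace 𝓘(ℝ, E) (γ t), u ≠ 0 →
      riccatiForm σ f (ψ t) (γ t) u u < 0 := by
    intro t ht hs
    have htI : t ∈ Ico 0 d := ⟨ht.1.le, ht.2⟩
    have hft := hf t htI
    have hn := eventually_contMDiffAt_grad hft
    have dn := hn.self_of_nhds.mdifferentiableAt (n := ∞) (by simp)
    have hnonpos : ∀ s ∈ Ico 0 t, ∀ u : TangentSpace 𝓘(ℝ, E) (γ s),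
        riccatiForm σ f (ψ s) (γ s) u u ≤ 0 := by
      intro s hst u
      rcases eq_or_ne u 0 with rfl | hu
      · simp [riccatiForm, hessian]
      · exact (hs s hst u hu).le
    have hleft : ∀ᶠ s in 𝓝[<] t, s ∈ Ico 0 t := by
      filter_upwards [Ioo_mem_nhdsLT ht.1] with s hs using ⟨hs.1.le, hs.2⟩
    have hle : ∀ u : TangentSpace 𝓘(ℝ, E) (γ t), riccatiForm σ f (ψ t) (γ t) u u ≤ 0 := by
      intro u
      have hX := eventually_contMDiffAt_extend u
      have hc := continuousWithinAt_riccatiForm (σ := σ) (s := Iio t) hft hX hX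
        (hγd t ht).continuousAt.continuousWithinAt (hψd t ht).continuousAt.continuousWithinAt
      have := le_of_tendsto hc (hleft.mono fun s h ↦ hnonpos s h _)
      simpa using this
    by_contra! hcon
    obtain ⟨w, hw, hwnonneg⟩ := hcon
    obtain ⟨v, hv1, hv0⟩ : ∃ v : TangentSpace 𝓘(ℝ, E) (γ t), ‖v‖ = 1 ∧
        riccatiForm σ f (ψ t) (γ t) v v = 0 := by
      refine ⟨‖w‖⁻¹ • w, by simp [norm_smul, hw], ?_⟩
      rw [riccatiForm_smul_left hft.self_of_nhds, riccatiForm_symm hft,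
        riccatiForm_smul_left hft.self_of_nhds, le_antisymm (hle w) hwnonneg]
      simp
    have hnull : ∀ u : TangentSpace 𝓘(ℝ, E) (γ t), riccatiForm σ f (ψ t) (γ t) v u = 0 := by
      intro u
      refine eq_zero_of_forall_two_mul_add_sq_mul_nonpos
        (c := riccatiForm σ f (ψ t) (γ t) u u) fun r ↦ ?_
      have := hle (v + r • u)
      rw [riccatiForm_add_left hft.self_of_nhds, riccatiForm_symm hft v,
        riccatiForm_symm hft (r • u), riccatiForm_add_left hft.self_of_nhds,
        riccatiForm_add_left hft.self_of_nhds, hv0, riccatiForm_symm hft v,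
        riccatiForm_smul_left hft.self_of_nhds, riccatiForm_smul_left hft.self_of_nhds,
        riccatiForm_symm hft u (r • u), riccatiForm_smul_left hft.self_of_nhds,
        riccatiForm_symm hft u v] at this
      linarith
    -- As `S n = 0` and `‖n‖ = 1`, pairing `v` with `n` leaves `-⟨v, n⟩`.
    have hvn : (inner ℝ v (grad E f (γ t)) : ℝ) = 0 := by
      have h1 := hnull (grad E f (γ t))
      rw [riccatiForm, hessian_grad_right_eq_zero hft.self_of_nhds (hunit t ht),
        real_inner_self_eq_norm_sq, (hunit t ht).self_of_nhds] at h1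
      linarith
    have hσ0 : σ ≠ 0 := by rcases hσ with h | h <;> rw [h] <;> norm_num
    have hSv : covDeriv (grad E f) (γ t) v = ψ t • v := by
      refine ext_inner_right ℝ fun u ↦ ?_
      have h1 := hnull u
      rw [riccatiForm, hvn, hessian] at h1
      rw [real_inner_smul_left]
      refine mul_left_cancel₀ hσ0 ?_
      linarith
    set X := FiberBundle.extend E v with hXdef
    have hXt : X (γ t) = v := by simp [X]
    have hX : ∀ᶠ q in 𝓝 (γ t), CMDiffAt ∞ (T% X) q := eventually_contMDiffAt_extend v
    have dX := hX.self_of_nhds.mdifferentiableAt (n := ∞) (by simp)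
    have D1 := hasDerivAt_comp_curve (mdifferentiableAt_hessian hft hX hX) (hγd t ht) (hγ' t ht)
    have D2 := hasDerivAt_comp_curve (mdifferentiableAt_inner dX dX) (hγd t ht) (hγ' t ht)
    have D3 := hasDerivAt_comp_curve (mdifferentiableAt_inner dX dn) (hγd t ht) (hγ' t ht)
    have D := ((D1.const_mul σ).sub (((hψd t ht).const_mul σ).mul (D2.sub (D3.mul D3)))).sub
      (D3.mul D3)
    set F : ℝ → ℝ := fun s ↦ riccatiForm σ f (ψ s) (γ s) (X (γ s)) (X (γ s)) with hF
    -- The terms `2 σ ⟨S v, ∇_n X⟩` and `-2 σ ψ ⟨v, ∇_n X⟩` cancel because `S v = ψ v`, and `⟨X,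
    -- n⟩²` has derivative zero because `⟨v, n⟩ = 0`.
    have hder : HasDerivAt F
        (σ * (-sectionalCurv (γ t) v (grad E f (γ t)) - ψ t ^ 2 - ψ' t)) t := by
      refine (show HasDerivAt F _ t from D).congr_deriv ?_
      simp only [Pi.sub_apply, Pi.mul_apply]
      rw [mvfderiv_hessian_grad hft (hunit t ht), mvfderiv_inner_apply dX dX, hXt, hvn, hSv,
        sectionalCurv, hv1, (hunit t ht).self_of_nhds, hvn, norm_smul, hv1, real_inner_smul_left,
        real_inner_self_eq_norm_sq, hv1, ← hXdef,
        real_inner_comm v (covDeriv X (γ t) (grad E f (γ t)))]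
      simp
      ring
    have hneg := hK t ht v hv1 hvn
    -- A negative derivative at a zero of `F` forces `F > 0` just before `t`, whereas `F ≤ 0` there.
    have hslope := (hasDerivAt_iff_tendsto_slope.1 hder).eventually_lt_const hneg
    have hslope' : ∀ᶠ s in 𝓝[<] t, slope F t s < 0 :=
      nhdsWithin_mono t (fun s hs ↦ ne_of_lt hs) hslope
    obtain ⟨s, hs1, hs2⟩ := (hslope'.and hleft).exists
    have hFt : F t = 0 := by simp only [hF, hXt, hv0]
    have hFs : F s ≤ 0 := hnonpos s hs2 _
    rw [slope_def_field, hFt, sub_zero] at hs1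
    exact absurd hs1 (not_lt.2 (div_nonneg_of_nonpos hFs (by linarith [hs2.2])))
  by_contra! hcon
  obtain ⟨t₀, ht₀, u₀, hu₀, hbad₀⟩ := hcon
  -- At the infimum of the bad times the form is still negative definite, by `h0` or by `step`;
  -- openness then excludes bad times shortly afterwards.
  set B := {t | t ∈ Ico 0 d ∧ ∃ u : TangentSpace 𝓘(ℝ, E) (γ t), u ≠ 0 ∧
    0 ≤ riccatiForm σ f (ψ t) (γ t) u u} with hB
  have hBne : B.Nonempty := ⟨t₀, ht₀, u₀, hu₀, hbad₀⟩
  have hBbdd : BddBelow B := ⟨0, fun t ht ↦ ht.1.1⟩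
  set t₁ := sInf B with ht₁
  have ht₁0 : 0 ≤ t₁ := le_csInf hBne fun t ht ↦ ht.1.1
  have ht₁d : t₁ < d := (csInf_le hBbdd hBne.some_mem).trans_lt hBne.some_mem.1.2
  have hbefore : ∀ s ∈ Ico 0 t₁, ∀ u : TangentSpace 𝓘(ℝ, E) (γ s), u ≠ 0 →
      riccatiForm σ f (ψ s) (γ s) u u < 0 := by
    intro s hs u hu
    by_contra! hle
    exact absurd (csInf_le hBbdd (⟨⟨hs.1, hs.2.trans ht₁d⟩, u, hu, hle⟩ : s ∈ B)) (not_le.2 hs.2)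
  have hat : ∀ u : TangentSpace 𝓘(ℝ, E) (γ t₁), u ≠ 0 →
      riccatiForm σ f (ψ t₁) (γ t₁) u u < 0 := by
    rcases ht₁0.eq_or_lt with h | h
    · rw [← h]; exact h0
    · exact step t₁ ⟨h, ht₁d⟩ hbefore
  have hmem : t₁ ∈ Ico 0 d := ⟨ht₁0, ht₁d⟩
  have hev := eventually_riccatiForm_neg (hf t₁ hmem) (hγ t₁ hmem) (hψ t₁ hmem) hat
  obtain ⟨ε, hε, hball⟩ := Metric.mem_nhdsWithin_iff.1 hev
  obtain ⟨b, hb, hbε⟩ := exists_lt_of_csInf_lt hBne (lt_add_of_pos_right t₁ hε)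
  have hbt : t₁ ≤ b := csInf_le hBbdd hb
  have hbneg := hball ⟨by rw [Metric.mem_ball, Real.dist_eq, abs_lt]; constructor <;> linarith,
    hb.1⟩
  obtain ⟨u, hu, hle⟩ := hb.2
  exact absurd (hbneg u hu) (not_lt.2 hle)

end RiccatiComparison

/-! ### Minimizing curves are integral curves of the gradient -/

section Distance

open Filter VectorField

variable {E : Type*} [NormedAddCommGroup E] [NormedSpace ℝ E] [FiniteDimensional ℝ E]
  {N : Type*} [MetricSpace N] [ChartedSpace E N] [IsManifold 𝓘(ℝ, E) ∞ N]
  [RiemannianBundle (fun p : N ↦ TangentSpace 𝓘(ℝ, E) p)]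
  [IsContMDiffRiemannianBundle 𝓘(ℝ, E) ∞ E (fun p : N ↦ TangentSpace 𝓘(ℝ, E) p)]

theorem continuousAt_norm_mfderiv_one {γ : ℝ → N} {t : ℝ}
    (hγ : ContMDiffAt 𝓘(ℝ, ℝ) 𝓘(ℝ, E) ∞ γ t) :
    ContinuousAt (fun s ↦ ‖mfderiv 𝓘(ℝ, ℝ) 𝓘(ℝ, E) γ s (1 : ℝ)‖) t := by
  have h1 := hγ.mfderiv_const (m := ∞) (by norm_cast)
  have hone : CMDiffAt ∞ (fun s : ℝ ↦ (⟨s, (1 : ℝ)⟩ : TangentBundle 𝓘(ℝ, ℝ) ℝ)) t :=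
    contMDiffAt_vectorSpace_iff_contDiffAt.2 contDiffAt_const
  have h2 := ContMDiffAt.clm_apply_of_inCoordinates (b₁ := id) (b₂ := γ)
    (v := fun s : ℝ ↦ ((1 : ℝ) : TangentSpace 𝓘(ℝ, ℝ) s))
    (ϕ := fun s ↦ mfderiv 𝓘(ℝ, ℝ) 𝓘(ℝ, E) γ s) h1 hone hγ
  have h3 : ContMDiffAt 𝓘(ℝ, ℝ) 𝓘(ℝ, ℝ) ∞
      (fun s ↦ (inner ℝ (mfderiv 𝓘(ℝ, ℝ) 𝓘(ℝ, E) γ s (1 : ℝ))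
        (mfderiv 𝓘(ℝ, ℝ) 𝓘(ℝ, E) γ s (1 : ℝ)) : ℝ)) t :=
    ContMDiffAt.inner_bundle (IB := 𝓘(ℝ, E)) (F := E)
      (E := fun p : N ↦ TangentSpace 𝓘(ℝ, E) p) (b := γ) h2 h2
  simpa only [norm_eq_sqrt_real_inner] using h3.continuousAt.sqrt

/-- Every tangent vector is the velocity of a smooth curve. -/
theorem exists_curve_mfderiv_eq (x : N) (v : TangentSpace 𝓘(ℝ, E) x) :
    ∃ c : ℝ → N, c 0 = x ∧ (∀ᶠ s in 𝓝 (0 : ℝ), ContMDiffAt 𝓘(ℝ, ℝ) 𝓘(ℝ, E) ∞ c s) ∧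
      (mfderiv 𝓘(ℝ, ℝ) 𝓘(ℝ, E) c 0 (1 : ℝ) : E) = (v : E) := by
  set φ := extChartAt 𝓘(ℝ, E) x
  set w : E := mfderiv 𝓘(ℝ, E) 𝓘(ℝ, E) φ x v with hw
  set a : ℝ → E := fun s ↦ φ x + s • w with ha
  have ha0 : a 0 = φ x := by simp [a]
  have ha_smooth : ContDiff ℝ ∞ a := contDiff_const.add (contDiff_id.smul contDiff_const)
  have htarget : φ.target ∈ 𝓝 (a 0) := by rw [ha0]; exact extChartAt_target_mem_nhds x
  have hsymm : ∀ᶠ z in 𝓝 (a 0), ContMDiffAt 𝓘(ℝ, E) 𝓘(ℝ, E) ∞ φ.symm z := by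
    filter_upwards [eventually_mem_nhds_iff.2 htarget] with z hz
    exact (contMDiffOn_extChartAt_symm x).contMDiffAt hz
  refine ⟨fun s ↦ φ.symm (a s), by simp [ha0, φ], ?_, ?_⟩
  · filter_upwards [ha_smooth.continuous.continuousAt.eventually hsymm] with s hs
    exact hs.comp s ha_smooth.contMDiff.contMDiffAt
  · have h1 : HasMFDerivAt 𝓘(ℝ, ℝ) 𝓘(ℝ, E) a 0 (ContinuousLinearMap.toSpanSingleton ℝ w) := by
      refine HasFDerivAt.hasMFDerivAt ?_
      have : HasDerivAt a w 0 := by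
        simpa [ha] using ((hasDerivAt_id (0 : ℝ)).smul_const w).const_add (φ x)
      exact this.hasFDerivAt
    have h2 := hsymm.self_of_nhds.mdifferentiableAt (n := ∞) (by simp)
    have h3 := (h2.hasMFDerivAt.comp (0 : ℝ) h1).mfderiv
    have h4 := mfderivWithin_extChartAt_symm_comp_mfderiv_extChartAt' (I := 𝓘(ℝ, E))
      (mem_extChartAt_source (I := 𝓘(ℝ, E)) x)
    have h5 : mfderivWithin 𝓘(ℝ, E) 𝓘(ℝ, E) φ.symm (range 𝓘(ℝ, E)) (φ x) w = v :=
      congrArg (fun L ↦ L v) h4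
    rw [ModelWithCorners.range_eq_univ, mfderivWithin_univ] at h5
    rw [← h5]
    refine (congrArg (fun L ↦ L (1 : ℝ)) h3).trans ?_
    rw [ha0]
    change (mfderiv 𝓘(ℝ, E) 𝓘(ℝ, E) φ.symm (φ x)) ((1 : ℝ) • w) = _
    rw [one_smul]

variable [IsRiemannianManifold 𝓘(ℝ, E) N]

/-- The distance of the endpoints of a curve is bounded by its speed. -/
theorem dist_le_of_norm_mfderiv_le {γ : ℝ → N} {a b C : ℝ} (hab : a ≤ b)
    (hγ : ContMDiffOn 𝓘(ℝ, ℝ) 𝓘(ℝ, E) ∞ γ (Icc a b))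
    (hC : ∀ t ∈ Ioo a b, ‖mfderiv 𝓘(ℝ, ℝ) 𝓘(ℝ, E) γ t (1 : ℝ)‖ ≤ C) :
    dist (γ a) (γ b) ≤ C * (b - a) := by
  rcases hab.eq_or_lt with rfl | hlt
  · simp
  have hC0 : 0 ≤ C := by
    obtain ⟨t, ht⟩ := nonempty_Ioo.2 hlt
    exact (norm_nonneg _).trans (hC t ht)
  have h1 : edist (γ a) (γ b) ≤ ENNReal.ofReal (C * (b - a)) := by
    rw [IsRiemannianManifold.out (I := 𝓘(ℝ, E)) (γ a) (γ b)]
    refine (riemannianEDist_le_pathELength (hγ.of_le (by norm_cast)) rfl rfl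
      hab).trans ?_
    rw [pathELength_eq_lintegral_mfderiv_Ioo]
    refine (MeasureTheory.setLIntegral_mono measurable_const (g := fun _ ↦ ENNReal.ofReal C)
      fun t ht ↦ ?_).trans ?_
    · rw [← ofReal_norm]
      exact ENNReal.ofReal_le_ofReal (hC t ht)
    · simp [ENNReal.ofReal_mul hC0]
  rw [edist_dist] at h1
  exact (ENNReal.ofReal_le_ofReal_iff (mul_nonneg hC0 (by linarith))).1 h1

/-- Along a curve with initial velocity `grad f`, the function grows at rate `‖grad f‖²`, while the
Lipschitz bound allows at most the speed `‖grad f‖`. -/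
theorem norm_grad_le_one {f : N → ℝ} {x : N} (hf : MDiffAt f x)
    (hlip : ∀ᶠ y in 𝓝 x, |f y - f x| ≤ dist y x) : ‖grad E f x‖ ≤ 1 := by
  obtain ⟨c, rfl, hc, hv⟩ := exists_curve_mfderiv_eq x (grad E f x)
  replace hv : mfderiv 𝓘(ℝ, ℝ) 𝓘(ℝ, E) c 0 (1 : ℝ) = grad E f (c 0) := hv
  have hder := hasDerivAt_comp_curve hf (hc.self_of_nhds.mdifferentiableAt (n := ∞) (by simp)) hv
  rw [← inner_grad, real_inner_self_eq_norm_sq] at hder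
  have hcont := continuousAt_norm_mfderiv_one hc.self_of_nhds
  -- The slack `ε` absorbs the variation of the speed of `c` on a short interval.
  have key : ∀ ε > 0, ‖grad E f (c 0)‖ ^ 2 ≤ ‖grad E f (c 0)‖ + ε := by
    intro ε hε
    have h1 : ∀ᶠ s in 𝓝 (0 : ℝ), ‖mfderiv 𝓘(ℝ, ℝ) 𝓘(ℝ, E) c s (1 : ℝ)‖
        ≤ ‖grad E f (c 0)‖ + ε := by
      refine (hcont.eventually_lt_const (?_ : _ < ‖grad E f (c 0)‖ + ε)).mono fun _ h ↦ h.le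
      exact (congrArg norm hv).trans_lt (lt_add_of_pos_right _ hε)
    obtain ⟨δ, hδ, hball⟩ := Metric.eventually_nhds_iff_ball.1 (h1.and hc)
    have hlip' := hc.self_of_nhds.continuousAt.eventually hlip
    have hslope := (hasDerivAt_iff_tendsto_slope.1 hder).mono_left
      (nhdsWithin_mono (0 : ℝ) (fun s hs ↦ ne_of_gt hs) : 𝓝[>] (0 : ℝ) ≤ 𝓝[≠] 0)
    refine le_of_tendsto hslope ?_
    filter_upwards [Ioo_mem_nhdsGT hδ, nhdsWithin_le_nhds hlip'] with s hs hls
    have hmem : ∀ t ∈ Icc 0 s, t ∈ Metric.ball (0 : ℝ) δ := fun t ht ↦ by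
      rw [Metric.mem_ball, Real.dist_eq, sub_zero, abs_of_nonneg ht.1]
      exact ht.2.trans_lt hs.2
    have hd := dist_le_of_norm_mfderiv_le hs.1.le
      (fun t ht ↦ (hball t (hmem t ht)).2.contMDiffWithinAt)
      (fun t ht ↦ (hball t (hmem t ⟨ht.1.le, ht.2.le⟩)).1)
    rw [slope_def_field, sub_zero, div_le_iff₀ hs.1]
    rw [dist_comm] at hls
    have := (le_abs_self _).trans hls
    linarith
  have h2 : ‖grad E f (c 0)‖ ^ 2 ≤ ‖grad E f (c 0)‖ := le_of_forall_pos_le_add key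
  by_contra! hlt
  nlinarith

section SignedDistance

variable {F : Type*} [NormedAddCommGroup F] [NormedSpace ℝ F]
  {S : Type*} [TopologicalSpace S] [ChartedSpace F S]
  {ι : S → N} {ν : ∀ s : S, TangentSpace 𝓘(ℝ, E) (ι s)} {U : Set N} {ϱ : N → ℝ}

theorem IsRegularSignedDist.contMDiffAt (hϱ : IsRegularSignedDist E ι ν U ϱ) {p : N}
    (hp : p ∈ U) : ContMDiffAt 𝓘(ℝ, E) 𝓘(ℝ, ℝ) ∞ ϱ p :=
  hϱ.smooth.contMDiffAt (hϱ.isOpen.mem_nhds hp)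

theorem IsRegularSignedDist.eventually_contMDiffAt (hϱ : IsRegularSignedDist E ι ν U ϱ) {p : N}
    (hp : p ∈ U) : ∀ᶠ q in 𝓝 p, ContMDiffAt 𝓘(ℝ, E) 𝓘(ℝ, ℝ) ∞ ϱ q := by
  filter_upwards [hϱ.isOpen.mem_nhds hp] with q hq using hϱ.contMDiffAt hq

theorem IsRegularSignedDist.norm_grad_le_one (hϱ : IsRegularSignedDist E ι ν U ϱ) {p : N}
    (hp : p ∈ U) (hpos : 0 < ϱ p) : ‖grad E ϱ p‖ ≤ 1 := by
  refine RiemannianComparison.norm_grad_le_one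
    ((hϱ.contMDiffAt hp).mdifferentiableAt (by simp)) ?_
  filter_upwards [(hϱ.contMDiffAt hp).continuousAt.eventually_const_lt hpos] with y hy
  rw [← abs_of_pos hy, ← abs_of_pos hpos, hϱ.abs_eq, hϱ.abs_eq]
  simpa [Real.dist_eq] using (Metric.lipschitz_infDist_pt (range ι)).dist_le_mul y p

variable {γ : ℝ → N} {p : N}

theorem IsMinimizingGeodesicFrom.dist_le {A : Set N} {d : ℝ}
    (hγ : IsMinimizingGeodesicFrom E A p d γ) {s t : ℝ} (hs : 0 ≤ s) (hst : s ≤ t) (ht : t ≤ d) :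
    dist (γ s) (γ t) ≤ t - s := by
  have := dist_le_of_norm_mfderiv_le hst (hγ.smooth.mono (Icc_subset_Icc hs ht))
    (fun r hr ↦ (hγ.unit_speed r ⟨hs.trans_lt hr.1, hr.2.trans_le ht⟩).le)
  simpa using this

/-- Both pieces of the curve, before and after time `t`, bound the distance to the hypersurface, so
`|ϱ (γ t)| = t`; continuity then fixes the sign. -/
theorem IsMinimizingGeodesicFrom.signedDist_eq (hϱ : IsRegularSignedDist E ι ν U ϱ)
    (hγ : IsMinimizingGeodesicFrom E (range ι) p (ϱ p) γ)
    (hγU : ∀ t ∈ Icc 0 (ϱ p), γ t ∈ U) {t : ℝ} (ht : t ∈ Icc 0 (ϱ p)) : ϱ (γ t) = t := by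
  have habs : ∀ s ∈ Icc 0 (ϱ p), |ϱ (γ s)| = s := by
    intro s hs
    rw [hϱ.abs_eq]
    refine le_antisymm ?_ ?_
    · have h1 := Metric.infDist_le_dist_of_mem (x := γ s) hγ.source
      have h2 := hγ.dist_le le_rfl hs.1 hs.2
      rw [dist_comm] at h1
      linarith
    · have h1 := Metric.infDist_le_infDist_add_dist (s := range ι) (x := p) (y := γ s)
      have h2 := hγ.dist_le hs.1 hs.2 le_rfl
      rw [hγ.target, dist_comm] at h2
      have h3 := hγ.length_eq
      linarith
  by_contra hne
  have htneg : ϱ (γ t) = -t := by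
    rcases abs_choice (ϱ (γ t)) with h | h
    · exact absurd (h.symm.trans (habs t ht)) hne
    · linarith [habs t ht]
  have ht0 : 0 < t := lt_of_le_of_ne ht.1 fun h ↦ hne (by rw [htneg, ← h, neg_zero])
  have hcont : ContinuousOn (fun s ↦ ϱ (γ s)) (Icc t (ϱ p)) := by
    intro s hs
    have hs' : s ∈ Icc 0 (ϱ p) := ⟨ht.1.trans hs.1, hs.2⟩
    exact (hϱ.contMDiffAt (hγU s hs')).continuousAt.comp_continuousWithinAt
      ((hγ.smooth.continuousOn s hs').mono (Icc_subset_Icc_left ht.1))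
  have hp : ϱ (γ (ϱ p)) = ϱ p := by rw [hγ.target]
  -- If `ϱ (γ t) = -t < 0`, then `ϱ ∘ γ` has a zero at some `s ≥ t > 0`, contradicting `|ϱ (γ s)| =
  -- s`.
  obtain ⟨s, hs, hs0⟩ := intermediate_value_Icc ht.2 hcont
    (show (0 : ℝ) ∈ Icc (ϱ (γ t)) (ϱ (γ (ϱ p))) from
      ⟨by rw [htneg]; linarith, by rw [hp]; linarith [ht.2]⟩)
  have := habs s ⟨ht.1.trans hs.1, hs.2⟩
  simp only at hs0
  rw [hs0, abs_zero] at this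
  linarith [hs.1]

theorem IsMinimizingGeodesicFrom.mdifferentiableAt {A : Set N} {d : ℝ}
    (hγ : IsMinimizingGeodesicFrom E A p d γ) {t : ℝ} (ht : t ∈ Ioo 0 d) :
    MDifferentiableAt 𝓘(ℝ, ℝ) 𝓘(ℝ, E) γ t :=
  (hγ.smooth.contMDiffAt (Icc_mem_nhds ht.1 ht.2)).mdifferentiableAt (by simp)

/-- Equality case of Cauchy-Schwarz: `⟨n, γ'⟩ = 1` with `‖n‖ ≤ 1` and `‖γ'‖ = 1` makes `‖n - γ'‖² ≤
0`. -/
theorem IsMinimizingGeodesicFrom.mfderiv_eq_grad (hϱ : IsRegularSignedDist E ι ν U ϱ)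
    (hγ : IsMinimizingGeodesicFrom E (range ι) p (ϱ p) γ)
    (hγU : ∀ t ∈ Icc 0 (ϱ p), γ t ∈ U) {t : ℝ} (ht : t ∈ Ioo 0 (ϱ p)) :
    mfderiv 𝓘(ℝ, ℝ) 𝓘(ℝ, E) γ t (1 : ℝ) = grad E ϱ (γ t) := by
  have htI : t ∈ Icc 0 (ϱ p) := ⟨ht.1.le, ht.2.le⟩
  have hval := hγ.signedDist_eq hϱ hγU htI
  have hle := hϱ.norm_grad_le_one (hγU t htI) (by rw [hval]; exact ht.1)
  have hder := hasDerivAt_comp_curve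
    ((hϱ.contMDiffAt (hγU t htI)).mdifferentiableAt (by simp)) (hγ.mdifferentiableAt ht) rfl
  have hid : (fun s ↦ ϱ (γ s)) =ᶠ[𝓝 t] id := by
    filter_upwards [Icc_mem_nhds ht.1 ht.2] with s hs using hγ.signedDist_eq hϱ hγU hs
  have hone := hder.unique ((hasDerivAt_id t).congr_of_eventuallyEq hid)
  rw [← inner_grad] at hone
  have hspeed := hγ.unit_speed t ht
  set w : TangentSpace 𝓘(ℝ, E) (γ t) := mfderiv 𝓘(ℝ, ℝ) 𝓘(ℝ, E) γ t (1 : ℝ)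
  have hsq := norm_sub_sq_real (grad E ϱ (γ t)) w
  have hw : ‖w‖ = 1 := hspeed
  rw [hone, hw] at hsq
  have h0 : ‖grad E ϱ (γ t) - w‖ ^ 2 ≤ 0 := by nlinarith [norm_nonneg (grad E ϱ (γ t))]
  have h1 : ‖grad E ϱ (γ t) - w‖ = 0 :=
    pow_eq_zero_iff two_ne_zero |>.1 (le_antisymm h0 (sq_nonneg _))
  exact (sub_eq_zero.1 (norm_eq_zero.1 h1)).symm

/-- The gradient of the signed distance has norm one at points which are reached by a
minimizing geodesic. -/
theorem IsMinimizingGeodesicFrom.norm_grad_eq_one (hϱ : IsRegularSignedDist E ι ν U ϱ)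
    (hγ : IsMinimizingGeodesicFrom E (range ι) p (ϱ p) γ)
    (hγU : ∀ t ∈ Icc 0 (ϱ p), γ t ∈ U) (hpos : 0 < ϱ p) {t : ℝ} (ht : t ∈ Icc 0 (ϱ p)) :
    ‖grad E ϱ (γ t)‖ = 1 := by
  have hcont : ContinuousOn (fun s ↦ ‖grad E ϱ (γ s)‖) (Icc 0 (ϱ p)) := by
    intro s hs
    have dn := contMDiffAt_grad (hϱ.contMDiffAt (hγU s hs))
    have := (contMDiffAt_inner dn dn).continuousAt.sqrt.comp_continuousWithinAt
      (hγ.smooth.continuousOn s hs)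
    simp only [norm_eq_sqrt_real_inner]
    exact this
  -- The velocity is identified with the gradient only at interior times; continuity extends the
  -- norm identity to both endpoints.
  refine Set.EqOn.of_subset_closure (s := Ioo 0 (ϱ p)) (t := Icc 0 (ϱ p))
    (f := fun s ↦ ‖grad E ϱ (γ s)‖) (g := fun _ ↦ 1) (fun s hs ↦ ?_) hcont continuousOn_const
    Ioo_subset_Icc_self (closure_Ioo hpos.ne).ge ht
  simp only
  rw [← hγ.mfderiv_eq_grad hϱ hγU hs]
  exact hγ.unit_speed s hs

end SignedDistance

end Distance

/-! ### Immersions have injective differential -/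

section Hypersurface

variable {E : Type*} [NormedAddCommGroup E] [NormedSpace ℝ E]
  {N : Type*} [TopologicalSpace N] [ChartedSpace E N] [IsManifold 𝓘(ℝ, E) ∞ N]
  {F : Type*} [NormedAddCommGroup F] [NormedSpace ℝ F]
  {S : Type*} [TopologicalSpace S] [ChartedSpace F S] [IsManifold 𝓘(ℝ, F) ∞ S]

theorem injective_mfderiv_of_isImmersionAt {ι : S → N} {s : S}
    (h : IsImmersionAt 𝓘(ℝ, F) 𝓘(ℝ, E) ∞ ι s) :
    Function.Injective (mfderiv 𝓘(ℝ, F) 𝓘(ℝ, E) ι s) := by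
  set x : F := h.domChart.extend 𝓘(ℝ, F) s with hx
  have hs : s ∈ (h.domChart.extend 𝓘(ℝ, F)).source := by
    simpa using h.mem_domChart_source
  have hval : ∀ s' ∈ h.domChart.source, (h.equiv.symm (h.codChart.extend 𝓘(ℝ, E) (ι s'))).1
      = h.domChart.extend 𝓘(ℝ, F) s' := by
    intro s' hs'
    have hs'' : s' ∈ (h.domChart.extend 𝓘(ℝ, F)).source := by simpa using hs'
    have h1 := h.writtenInCharts ((h.domChart.extend 𝓘(ℝ, F)).map_source hs'')
    simp only [Function.comp_apply, (h.domChart.extend 𝓘(ℝ, F)).left_inv hs''] at h1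
    rw [h1]
    simp
  -- In adapted charts the immersion is an inclusion of a factor, so projecting to that factor gives
  -- a local left inverse, differentiable at `ι s`.
  set g : N → S := fun y ↦ (h.domChart.extend 𝓘(ℝ, F)).symm
    (h.equiv.symm (h.codChart.extend 𝓘(ℝ, E) y)).1 with hg
  have hleft : (fun s' ↦ g (ι s')) =ᶠ[𝓝 s] id := by
    filter_upwards [h.domChart.open_source.mem_nhds h.mem_domChart_source] with s' hs'
    simp only [hg, hval s' hs', id]
    exact (h.domChart.extend 𝓘(ℝ, F)).left_inv (by simpa using hs')
  have d1 : MDifferentiableAt 𝓘(ℝ, E) 𝓘(ℝ, E) (h.codChart.extend 𝓘(ℝ, E)) (ι s) :=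
    (OpenPartialHomeomorph.contMDiffAt_extend h.codChart_mem_maximalAtlas
      h.mem_codChart_source).mdifferentiableAt (by simp)
  have d2 : MDifferentiableAt 𝓘(ℝ, E) 𝓘(ℝ, F)
      (fun z : E ↦ (h.equiv.symm z).1) (h.codChart.extend 𝓘(ℝ, E) (ι s)) :=
    (differentiableAt_fst.comp _ h.equiv.symm.differentiableAt).mdifferentiableAt
  have d3 : MDifferentiableAt 𝓘(ℝ, F) 𝓘(ℝ, F) (h.domChart.extend 𝓘(ℝ, F)).symm
      (h.equiv.symm (h.codChart.extend 𝓘(ℝ, E) (ι s))).1 := by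
    rw [hval s h.mem_domChart_source]
    refine ((contMDiffOn_extend_symm h.domChart_mem_maximalAtlas).contMDiffAt ?_).mdifferentiableAt
      (by simp)
    simpa using h.domChart.open_target.mem_nhds (h.domChart.map_source h.mem_domChart_source)
  have dg : MDifferentiableAt 𝓘(ℝ, E) 𝓘(ℝ, F) g (ι s) :=
    d3.comp (ι s) (d2.comp (ι s) d1)
  have dι := h.contMDiffAt.mdifferentiableAt (by simp)
  have hcomp := (dg.hasMFDerivAt.comp s dι.hasMFDerivAt).mfderiv
  have hid : mfderiv 𝓘(ℝ, F) 𝓘(ℝ, F) (g ∘ ι) s = ContinuousLinearMap.id ℝ _ :=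
    (hleft.mfderiv_eq).trans mfderiv_id
  intro v w hvw
  have key : ∀ u, mfderiv 𝓘(ℝ, E) 𝓘(ℝ, F) g (ι s) (mfderiv 𝓘(ℝ, F) 𝓘(ℝ, E) ι s u) = u :=
    fun u ↦ (congrArg (fun L ↦ L u) (hcomp.symm.trans hid) :)
  rw [← key v, hvw, key]

end Hypersurface

/-! ### The tangent space as the kernel of the differential -/

section TangentSpace

variable {E : Type*} [NormedAddCommGroup E] [NormedSpace ℝ E] [FiniteDimensional ℝ E]
  {N : Type*} [MetricSpace N] [ChartedSpace E N] [IsManifold 𝓘(ℝ, E) ∞ N]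
  [RiemannianBundle (fun p : N ↦ TangentSpace 𝓘(ℝ, E) p)]
  [IsContMDiffRiemannianBundle 𝓘(ℝ, E) ∞ E (fun p : N ↦ TangentSpace 𝓘(ℝ, E) p)]
  {F : Type*} [NormedAddCommGroup F] [NormedSpace ℝ F]
  {S : Type*} [TopologicalSpace S] [ChartedSpace F S] [IsManifold 𝓘(ℝ, F) ∞ S]
  {ι : S → N} {ν : ∀ s : S, TangentSpace 𝓘(ℝ, E) (ι s)} {U : Set N} {ϱ : N → ℝ}

/-- The tangent spaces of the hypersurface are the kernels of the differential of the signed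
distance. -/
theorem exists_mfderiv_eq_of_inner_grad_eq_zero (hS : IsOrientedHypersurface E F ι ν)
    (hϱ : IsRegularSignedDist E ι ν U ϱ) {s : S} (hs : ι s ∈ U)
    {v : TangentSpace 𝓘(ℝ, E) (ι s)} (hv : inner ℝ v (grad E ϱ (ι s)) = 0) :
    ∃ w, mfderiv 𝓘(ℝ, F) 𝓘(ℝ, E) ι s w = v := by
  have him := hS.embedding.isImmersion.isImmersionAt s
  have hinj := injective_mfderiv_of_isImmersionAt him
  have dι := him.contMDiffAt.mdifferentiableAt (by simp)
  have dϱ : MDiffAt ϱ (ι s) :=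
    (hϱ.smooth.contMDiffAt (hϱ.isOpen.mem_nhds hs)).mdifferentiableAt (by simp)
  let L : E →ₗ[ℝ] ℝ := (mvfderiv 𝓘(ℝ, E) ϱ (ι s)).toLinearMap
  let A : F →ₗ[ℝ] E := (mfderiv 𝓘(ℝ, F) 𝓘(ℝ, E) ι s).toLinearMap
  have hcomp : ∀ w : F, L (A w) = 0 := by
    intro w
    have h1 := (dϱ.hasMFDerivAt.comp s dι.hasMFDerivAt).mfderiv
    have h2 : (ϱ ∘ ι) = fun _ ↦ (0 : ℝ) := by
      funext s'
      have : ι s' ∈ ϱ ⁻¹' {0} := hϱ.zero_set ▸ mem_range_self s'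
      exact this
    rw [h2, mfderiv_const] at h1
    exact (congrArg (fun L ↦ L w) h1.symm :)
  have hLsurj : LinearMap.range L = ⊤ := by
    refine LinearMap.range_eq_top.2 (LinearMap.surjective fun h0 ↦ ?_)
    have h1 := hϱ.sign s hs
    have h2 : mvfderiv 𝓘(ℝ, E) ϱ (ι s) (ν s) = 0 := (congrArg (fun L ↦ L (ν s)) h0 :)
    exact h1.ne' h2
  have hAinj : Function.Injective A := hinj
  -- `ϱ ∘ ι = 0` gives the inclusion; the dimensions agree because `A` is injective, `L ≠ 0` by the
  -- sign condition, and the codimension is one.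
  have hle : LinearMap.range A ≤ LinearMap.ker L := by
    rintro _ ⟨w, rfl⟩
    exact hcomp w
  have hfr : Module.finrank ℝ (LinearMap.range A) = Module.finrank ℝ F :=
    LinearMap.finrank_range_of_inj hAinj
  have hker := LinearMap.finrank_range_add_finrank_ker L
  rw [hLsurj, finrank_top, Module.finrank_self] at hker
  have hcodim := hS.codim_one
  have heq := Submodule.eq_of_le_of_finrank_eq hle (by omega)
  have hvker : (v : E) ∈ LinearMap.ker L := by
    have : mvfderiv 𝓘(ℝ, E) ϱ (ι s) v = 0 := by rw [← inner_grad, real_inner_comm, hv]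
    exact this
  rw [← heq] at hvker
  exact hvker

end TangentSpace

/-! ### Perturbed logarithmic derivative and the comparison -/

section Comparison

open Filter

variable {E : Type*} [NormedAddCommGroup E] [NormedSpace ℝ E] [FiniteDimensional ℝ E]
  {N : Type*} [MetricSpace N] [ChartedSpace E N] [IsManifold 𝓘(ℝ, E) ∞ N]
  [RiemannianBundle (fun p : N ↦ TangentSpace 𝓘(ℝ, E) p)]
  [IsContMDiffRiemannianBundle 𝓘(ℝ, E) ∞ E (fun p : N ↦ TangentSpace 𝓘(ℝ, E) p)]

/-- A perturbation of the logarithmic derivative `h' / h`, which turns a solution of the Riccati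
equation into a strict super- or subsolution. -/
def perturbedLogDeriv (σ : ℝ) (h : ℝ → ℝ) (ε t : ℝ) : ℝ :=
  deriv h t / h t + σ * (ε * (1 + t) / h t ^ 2)

/-- For `η = ε (1 + t) / h²` one has `η' + 2 (h' / h) η = ε / h²`: the weight `1 / h²` absorbs the
cross term of the square, and the factor `1 + t` leaves a strict gain while keeping `η` positive at
`t = 0`. -/
theorem hasDerivAt_perturbedLogDeriv {h G : ℝ → ℝ} (hh : ContDiff ℝ 2 h)
    (hODE : ∀ t, deriv (deriv h) t - G t * h t = 0) (σ ε : ℝ) {t : ℝ} (ht : h t ≠ 0) :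
    HasDerivAt (perturbedLogDeriv σ h ε)
      (G t + σ * (ε / h t ^ 2) + σ ^ 2 * (ε * (1 + t) / h t ^ 2) ^ 2
        - perturbedLogDeriv σ h ε t ^ 2) t := by
  have d1 : HasDerivAt h (deriv h t) t := (hh.differentiable (by simp) t).hasDerivAt
  have hh' : ContDiff ℝ 1 (deriv h) := by
    have : ContDiff ℝ (1 + 1) h := by simpa [one_add_one_eq_two] using hh
    exact (contDiff_succ_iff_deriv.1 this).2.2
  have d2 : HasDerivAt (deriv h) (deriv (deriv h) t) t :=
    (hh'.differentiable (by simp) t).hasDerivAt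
  rw [sub_eq_zero.1 (hODE t)] at d2
  have d3 := (((hasDerivAt_id t).const_add 1).const_mul ε).div (d1.pow 2) (pow_ne_zero 2 ht)
  refine ((d2.div d1 ht).add (d3.const_mul σ)).congr_deriv ?_
  simp only [perturbedLogDeriv, id, Pi.pow_apply]
  field_simp
  ring

/-- The inequality means `η² < ε / h²` for `η = ε (1 + t) / h²`: the quadratic error of the
perturbation stays below its linear gain. A positive minimum of `h` on the compact interval provides
it for small `ε`. -/
theorem exists_forall_mul_sq_lt {h : ℝ → ℝ} {d : ℝ} (hd : 0 ≤ d) (hh : ContinuousOn h (Icc 0 d))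
    (hpos : ∀ t ∈ Icc 0 d, 0 < h t) :
    ∀ᶠ ε in 𝓝[>] (0 : ℝ), ∀ t ∈ Icc 0 d, ε * (1 + t) ^ 2 < h t ^ 2 := by
  obtain ⟨t₀, ht₀, hmin⟩ := isCompact_Icc.exists_isMinOn (nonempty_Icc.2 hd) hh
  have hlim : ∀ᶠ ε in 𝓝 (0 : ℝ), ε * (1 + d) ^ 2 < h t₀ ^ 2 := by
    refine (show Continuous fun ε : ℝ ↦ ε * (1 + d) ^ 2 by fun_prop).continuousAt.eventually_lt_const
      ?_
    simpa using pow_pos (hpos t₀ ht₀) 2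
  filter_upwards [self_mem_nhdsWithin, nhdsWithin_le_nhds hlim] with ε hε h1 t ht
  calc ε * (1 + t) ^ 2 ≤ ε * (1 + d) ^ 2 :=
        mul_le_mul_of_nonneg_left (pow_le_pow_left₀ (by linarith [ht.1]) (by linarith [ht.2]) 2)
          (le_of_lt hε)
    _ < h t₀ ^ 2 := h1
    _ ≤ h t ^ 2 := pow_le_pow_left₀ (hpos t₀ ht₀).le (hmin ht) 2

/-- The form is negative definite if it is so on the orthogonal complement of the gradient. -/
theorem riccatiForm_neg_of_orthogonal {f : N → ℝ} {p : N} {σ c c' : ℝ}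
    (hf : ∀ᶠ q in 𝓝 p, ContMDiffAt 𝓘(ℝ, E) 𝓘(ℝ, ℝ) ∞ f q)
    (hn : ‖grad E f p‖ = 1) (hess : ∀ v, hessian f p v (grad E f p) = 0)
    (hle : ∀ v : TangentSpace 𝓘(ℝ, E) p, inner ℝ v (grad E f p) = 0 →
      σ * hessian f p v v ≤ σ * c' * ‖v‖ ^ 2)
    (hc : σ * c' < σ * c) (u : TangentSpace 𝓘(ℝ, E) p) (hu : u ≠ 0) :
    riccatiForm σ f c p u u < 0 := by
  set n := grad E f p with hndef
  set a : ℝ := inner ℝ u n with ha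
  set v := u - a • n with hv
  have hnn : (inner ℝ n n : ℝ) = 1 := by rw [real_inner_self_eq_norm_sq, hn, one_pow]
  have hvn : (inner ℝ v n : ℝ) = 0 := by
    rw [hv, inner_sub_left, real_inner_smul_left, hnn, ← ha]; ring
  have huv : u = v + a • n := by simp [hv]
  have hvv : ‖v‖ ^ 2 = inner ℝ u u - a * a := by
    rw [huv, ← real_inner_self_eq_norm_sq]
    simp only [inner_add_left, inner_add_right, real_inner_smul_left, real_inner_smul_right, hnn,
      hvn, real_inner_comm v n]
    ring
  -- With `u = v + a n` the form equals `σ (∇²f(v, v) - c ‖v‖²) - a²`, which is negative through its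
  -- first part if `v ≠ 0` and through `-a²` otherwise.
  have hHess : hessian f p u u = hessian f p v v := by
    have h1 : hessian f p n v = 0 := by rw [hessian_symm hf, hess]
    rw [huv, hessian_add_right, hessian_smul_right, hess, hessian_add_left hf.self_of_nhds,
      hessian_smul_left hf.self_of_nhds, h1]
    ring
  have h1 := hle v hvn
  rw [riccatiForm, ← hndef, ← ha, ← hvv, hHess]
  rcases eq_or_ne v 0 with h0 | h0
  · have ha0 : a ≠ 0 := by
      rintro h2
      rw [h0, h2] at huv
      exact hu (by simpa using huv)
    rw [h0] at h1 ⊢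
    simp only [norm_zero] at h1 ⊢
    nlinarith [mul_self_pos.2 ha0]
  · have : 0 < ‖v‖ ^ 2 := by positivity
    nlinarith [mul_self_nonneg a]

variable [IsRiemannianManifold 𝓘(ℝ, E) N]
  {F : Type*} [NormedAddCommGroup F] [NormedSpace ℝ F]
  {S : Type*} [TopologicalSpace S] [ChartedSpace F S] [IsManifold 𝓘(ℝ, F) ∞ S]
  {ι : S → N} {ν : ∀ s : S, TangentSpace 𝓘(ℝ, E) (ι s)} {U : Set N} {ϱ : N → ℝ}

/-- The gradient of the signed distance is in the kernel of its Hessian along a minimizing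
geodesic, up to the hypersurface. -/
theorem IsMinimizingGeodesicFrom.hessian_grad_right_source_eq_zero
    (hϱ : IsRegularSignedDist E ι ν U ϱ) {p : N} {γ : ℝ → N}
    (hγ : IsMinimizingGeodesicFrom E (range ι) p (ϱ p) γ)
    (hγU : ∀ t ∈ Icc 0 (ϱ p), γ t ∈ U) (hpos : 0 < ϱ p)
    (hunit : ∀ t ∈ Ioo 0 (ϱ p), ∀ᶠ q in 𝓝 (γ t), ‖grad E ϱ q‖ = 1)
    (v : TangentSpace 𝓘(ℝ, E) (γ 0)) : hessian ϱ (γ 0) v (grad E ϱ (γ 0)) = 0 := by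
  have h0 : (0 : ℝ) ∈ Icc 0 (ϱ p) := ⟨le_rfl, hpos.le⟩
  have hf := hϱ.eventually_contMDiffAt (hγU 0 h0)
  have hc := (mdifferentiableAt_hessian hf (eventually_contMDiffAt_extend v)
    (eventually_contMDiffAt_grad hf)).continuousAt.comp_continuousWithinAt
      ((hγ.smooth.continuousOn 0 h0).mono Ioo_subset_Icc_self)
  have hne : (𝓝[Ioo 0 (ϱ p)] (0 : ℝ)).NeBot := left_nhdsWithin_Ioo_neBot hpos
  -- At `γ 0` the gradient is not known to have norm one on a full neighbourhood, so the identity is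
  -- obtained as a limit from interior times.
  have hlim : Tendsto ((fun q ↦ hessian ϱ q (FiberBundle.extend E v q) (grad E ϱ q)) ∘ γ)
      (𝓝[Ioo 0 (ϱ p)] 0) (𝓝 0) := by
    refine tendsto_const_nhds.congr' ?_
    filter_upwards [self_mem_nhdsWithin] with t ht
    exact (hessian_grad_right_eq_zero (hϱ.contMDiffAt (hγU t ⟨ht.1.le, ht.2.le⟩))
      (hunit t ht) _).symm
  have := tendsto_nhds_unique hc hlim
  simpa using this

/-- Hessian comparison, with the sign `σ` distinguishing the upper and the lower bound. -/
theorem hessian_comparison {σ : ℝ} (hσ : σ = 1 ∨ σ = -1) (hS : IsOrientedHypersurface E F ι ν)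
    (hϱ : IsRegularSignedDist E ι ν U ϱ)
    (hU : ∀ p ∈ U, 0 ≤ ϱ p → ∃ γ : ℝ → N,
      IsMinimizingGeodesicFrom E (range ι) p (ϱ p) γ ∧ ∀ t ∈ Icc 0 (ϱ p), γ t ∈ U)
    {G h : ℝ → ℝ} (hh : ContDiff ℝ 2 h) (hODE : ∀ t, deriv (deriv h) t - G t * h t = 0)
    (hcurv : ∀ p ∈ U, ∀ v : TangentSpace 𝓘(ℝ, E) p, ‖v‖ = 1 → inner ℝ v (grad E ϱ p) = 0 →
      σ * (-sectionalCurv p v (grad E ϱ p) - G (ϱ p)) ≤ 0)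
    (hinit : ∀ s, ι s ∈ U → ∀ w : TangentSpace 𝓘(ℝ, F) s,
      σ * hessian ϱ (ι s) (mfderiv 𝓘(ℝ, F) 𝓘(ℝ, E) ι s w) (mfderiv 𝓘(ℝ, F) 𝓘(ℝ, E) ι s w) ≤
        σ * (deriv h 0 / h 0) * ‖mfderiv 𝓘(ℝ, F) 𝓘(ℝ, E) ι s w‖ ^ 2)
    {p : N} (hp : p ∈ U) (hp0 : 0 ≤ ϱ p) (hpos : ∀ t ∈ Icc 0 (ϱ p), 0 < h t)
    {v : TangentSpace 𝓘(ℝ, E) p} (hv : inner ℝ v (grad E ϱ p) = 0) :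
    σ * hessian ϱ p v v ≤ σ * (deriv h (ϱ p) / h (ϱ p)) * ‖v‖ ^ 2 := by
  have hinit' : ∀ q ∈ range ι, q ∈ U → ∀ v : TangentSpace 𝓘(ℝ, E) q,
      inner ℝ v (grad E ϱ q) = 0 →
      σ * hessian ϱ q v v ≤ σ * (deriv h 0 / h 0) * ‖v‖ ^ 2 := by
    rintro _ ⟨s, rfl⟩ hs v hv
    obtain ⟨w, rfl⟩ := exists_mfderiv_eq_of_inner_grad_eq_zero hS hϱ hs hv
    exact hinit s hs w
  rcases hp0.eq_or_lt with h0 | hd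
  · rw [← h0]
    refine hinit' p ?_ hp v hv
    rw [← hϱ.zero_set]
    exact h0.symm
  have hσ2 : σ ^ 2 = 1 := by rcases hσ with rfl | rfl <;> norm_num
  obtain ⟨γ, hγ, hγU⟩ := hU p hp hp0
  have hUγ : ∀ t ∈ Icc 0 (ϱ p), ∀ᶠ q in 𝓝 (γ t), ContMDiffAt 𝓘(ℝ, E) 𝓘(ℝ, ℝ) ∞ ϱ q :=
    fun t ht ↦ hϱ.eventually_contMDiffAt (hγU t ht)
  have hunit : ∀ t ∈ Ioo 0 (ϱ p), ∀ᶠ q in 𝓝 (γ t), ‖grad E ϱ q‖ = 1 := by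
    intro t ht
    have htI : t ∈ Icc 0 (ϱ p) := ⟨ht.1.le, ht.2.le⟩
    have hval : 0 < ϱ (γ t) := by rw [hγ.signedDist_eq hϱ hγU htI]; exact ht.1
    filter_upwards [hϱ.isOpen.mem_nhds (hγU t htI),
      (hϱ.contMDiffAt (hγU t htI)).continuousAt.eventually_const_lt hval] with q hq hq0
    -- Each nearby `q` is the endpoint of its own minimizing curve, which gives the norm identity on
    -- a whole neighbourhood of `γ t`.
    obtain ⟨c, hc, hcU⟩ := hU q hq hq0.le
    have := hc.norm_grad_eq_one hϱ hcU hq0 (t := ϱ q) ⟨hq0.le, le_rfl⟩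
    rwa [hc.target] at this
  have h0I : (0 : ℝ) ∈ Icc 0 (ϱ p) := ⟨le_rfl, hd.le⟩
  have hdI : ϱ p ∈ Icc 0 (ϱ p) := ⟨hd.le, le_rfl⟩
  have hψ : ∀ ε, ∀ t ∈ Icc 0 (ϱ p), HasDerivAt (perturbedLogDeriv σ h ε) _ t :=
    fun ε t ht ↦ hasDerivAt_perturbedLogDeriv hh hODE σ ε (hpos t ht).ne'
  have hlt : ∀ᶠ ε in 𝓝[>] (0 : ℝ), ∀ t ∈ Ico 0 (ϱ p), ∀ u : TangentSpace 𝓘(ℝ, E) (γ t),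
      u ≠ 0 → riccatiForm σ ϱ (perturbedLogDeriv σ h ε t) (γ t) u u < 0 := by
    filter_upwards [self_mem_nhdsWithin,
      exists_forall_mul_sq_lt hd.le hh.continuous.continuousOn hpos] with ε hε hεh
    refine riccatiForm_neg_of_riccati hσ (fun t ht ↦ hUγ t (Ico_subset_Icc_self ht))
      (hγ.smooth.continuousOn.mono Ico_subset_Icc_self) (fun t ht ↦ hγ.mdifferentiableAt ht)
      (fun t ht ↦ hγ.mfderiv_eq_grad hϱ hγU ht) hunit
      (fun t ht ↦ (hψ ε t (Ico_subset_Icc_self ht)).continuousAt.continuousWithinAt)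
      (fun t ht ↦ hψ ε t (Ioo_subset_Icc_self ht)) ?_ ?_
    · refine riccatiForm_neg_of_orthogonal (hUγ 0 h0I) (hγ.norm_grad_eq_one hϱ hγU hd h0I)
        (hγ.hessian_grad_right_source_eq_zero hϱ hγU hd hunit)
        (hinit' _ hγ.source (hγU 0 h0I)) ?_
      have h1 : 0 < ε * (1 + 0) / h 0 ^ 2 := by
        have := hpos 0 h0I
        have : 0 < ε := hε
        positivity
      rw [perturbedLogDeriv]
      nlinarith
    · intro t ht v hv1 hvn
      have htI := Ioo_subset_Icc_self ht
      have hK := hcurv _ (hγU t htI) v hv1 hvn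
      rw [hγ.signedDist_eq hϱ hγU htI] at hK
      have hht := hpos t htI
      have h1 : (ε * (1 + t) / h t ^ 2) ^ 2 < ε / h t ^ 2 := by
        rw [div_pow, div_lt_div_iff₀ (by positivity) (by positivity)]
        have h2 := mul_lt_mul_of_pos_left (hεh t htI)
          (show 0 < ε * h t ^ 2 from mul_pos hε (by positivity))
        nlinarith
      -- The perturbation contributes `-ε / h² - σ η²`, where `η = ε (1 + t) / h²`. For `σ = -1` the
      -- quadratic term has the wrong sign and is dominated by means of `h1`.
      have h3 : -(ε * (1 + t) / h t ^ 2) ^ 2 ≤ σ * (ε * (1 + t) / h t ^ 2) ^ 2 := by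
        rcases hσ with rfl | rfl <;> nlinarith [sq_nonneg (ε * (1 + t) / h t ^ 2)]
      rw [hσ2]
      have h4 : σ * (σ * (ε / h t ^ 2)) = ε / h t ^ 2 := by
        rw [← mul_assoc, ← sq, hσ2, one_mul]
      linarith
  have hne : (𝓝[Ico 0 (ϱ p)] (ϱ p)).NeBot := right_nhdsWithin_Ico_neBot hd
  -- For fixed `ε` the time tends to `ϱ p`; strictness is lost, and on vectors orthogonal to the
  -- gradient the form reduces to the desired difference.
  have hend : ∀ᶠ ε in 𝓝[>] (0 : ℝ), ∀ u : TangentSpace 𝓘(ℝ, E) (γ (ϱ p)),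
      inner ℝ u (grad E ϱ (γ (ϱ p))) = 0 →
      σ * hessian ϱ (γ (ϱ p)) u u ≤ σ * perturbedLogDeriv σ h ε (ϱ p) * ‖u‖ ^ 2 := by
    filter_upwards [hlt] with ε hε u hu
    have hX := eventually_contMDiffAt_extend u
    have hc := continuousWithinAt_riccatiForm (σ := σ) (s := Ico 0 (ϱ p)) (hUγ _ hdI) hX hX
      ((hγ.smooth.continuousOn _ hdI).mono Ico_subset_Icc_self)
      (hψ ε _ hdI).continuousAt.continuousWithinAt
    have hle := le_of_tendsto (b := 0) hc (by
      filter_upwards [self_mem_nhdsWithin] with t ht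
      rcases eq_or_ne (FiberBundle.extend E u (γ t)) 0 with h0 | h0
      · rw [h0]; simp [riccatiForm, hessian]
      · exact (hε t ht _ h0).le)
    simp only [FiberBundle.extend_apply_self, riccatiForm, hu, real_inner_self_eq_norm_sq] at hle
    linarith
  rw [hγ.target] at hend
  have hcont : Tendsto (fun ε ↦ σ * perturbedLogDeriv σ h ε (ϱ p) * ‖v‖ ^ 2) (𝓝[>] (0 : ℝ))
      (𝓝 (σ * (deriv h (ϱ p) / h (ϱ p)) * ‖v‖ ^ 2)) := by
    have : Continuous fun ε ↦ σ * perturbedLogDeriv σ h ε (ϱ p) * ‖v‖ ^ 2 := by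
      unfold perturbedLogDeriv
      fun_prop
    have h1 := this.tendsto 0
    simp only [perturbedLogDeriv, zero_mul, zero_div, mul_zero, add_zero] at h1
    exact h1.mono_left nhdsWithin_le_nhds
  exact ge_of_tendsto hcont (hend.mono fun ε hε ↦ hε v hv)

end Comparison

end RiemannianComparison

end

theorem theorem2p1
    {E : Type*} [NormedAddCommGroup E] [NormedSpace ℝ E] [FiniteDimensional ℝ E]
    {N : Type*} [MetricSpace N] [ChartedSpace E N] [IsManifold 𝓘(ℝ, E) ∞ N]
    [RiemannianBundle (fun p : N ↦ TangentSpace 𝓘(ℝ, E) p)]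
    [IsContMDiffRiemannianBundle 𝓘(ℝ, E) ∞ E (fun p : N ↦ TangentSpace 𝓘(ℝ, E) p)]
    [IsRiemannianManifold 𝓘(ℝ, E) N]
    {F : Type*} [NormedAddCommGroup F] [NormedSpace ℝ F]
    {S : Type*} [TopologicalSpace S] [ChartedSpace F S] [IsManifold 𝓘(ℝ, F) ∞ S]
    (ι : S → N) (ν : ∀ s : S, TangentSpace 𝓘(ℝ, E) (ι s))
    (hS : RiemannianComparison.IsOrientedHypersurface E F ι ν)
    (U : Set N) (ϱ : N → ℝ)
    (hϱ : RiemannianComparison.IsRegularSignedDist E ι ν U ϱ)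
    -- the part of `U` where `ϱ ≥ 0` is swept out by minimizing geodesics issuing from `Σ₀`
    (hU : ∀ p ∈ U, 0 ≤ ϱ p → ∃ γ : ℝ → N,
      RiemannianComparison.IsMinimizingGeodesicFrom E (range ι) p (ϱ p) γ ∧
      ∀ t ∈ Icc 0 (ϱ p), γ t ∈ U)
    (G : ℝ → ℝ) (hG : ContDiff ℝ ∞ G) (hGeven : Function.Even G)
    (h : ℝ → ℝ) (hh : ContDiff ℝ 2 h) (hODE : ∀ t, deriv (deriv h) t - G t * h t = 0)
    (dLow dUp : EReal) (hLow : dLow < 0) (hUp : 0 < dUp)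
    (hmax : RiemannianComparison.IsMaximalPositivityInterval h dLow dUp) :
    ((∀ p ∈ U, ∀ v : TangentSpace 𝓘(ℝ, E) p, ‖v‖ = 1 →
          inner ℝ v (RiemannianComparison.grad E ϱ p) = 0 →
          -G (ϱ p) ≤ RiemannianComparison.sectionalCurv p v (RiemannianComparison.grad E ϱ p)) →
      (∀ s, ι s ∈ U → ∀ w : TangentSpace 𝓘(ℝ, F) s,
          RiemannianComparison.hessian ϱ (ι s)
              (mfderiv 𝓘(ℝ, F) 𝓘(ℝ, E) ι s w) (mfderiv 𝓘(ℝ, F) 𝓘(ℝ, E) ι s w) ≤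
            deriv h 0 / h 0 * ‖mfderiv 𝓘(ℝ, F) 𝓘(ℝ, E) ι s w‖ ^ 2) →
      ∀ p ∈ U, ∀ v : TangentSpace 𝓘(ℝ, E) p,
        inner ℝ v (RiemannianComparison.grad E ϱ p) = 0 →
        0 ≤ ϱ p → (ϱ p : EReal) < dUp →
        RiemannianComparison.hessian ϱ p v v ≤ deriv h (ϱ p) / h (ϱ p) * ‖v‖ ^ 2) ∧
    ((∀ p ∈ U, ∀ v : TangentSpace 𝓘(ℝ, E) p, ‖v‖ = 1 →
          inner ℝ v (RiemannianComparison.grad E ϱ p) = 0 →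
          RiemannianComparison.sectionalCurv p v (RiemannianComparison.grad E ϱ p) ≤ -G (ϱ p)) →
      (∀ s, ι s ∈ U → ∀ w : TangentSpace 𝓘(ℝ, F) s,
          deriv h 0 / h 0 * ‖mfderiv 𝓘(ℝ, F) 𝓘(ℝ, E) ι s w‖ ^ 2 ≤
            RiemannianComparison.hessian ϱ (ι s)
              (mfderiv 𝓘(ℝ, F) 𝓘(ℝ, E) ι s w) (mfderiv 𝓘(ℝ, F) 𝓘(ℝ, E) ι s w)) →
      ∀ p ∈ U, ∀ v : TangentSpace 𝓘(ℝ, E) p,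
        inner ℝ v (RiemannianComparison.grad E ϱ p) = 0 →
        0 ≤ ϱ p → (ϱ p : EReal) < dUp →
        deriv h (ϱ p) / h (ϱ p) * ‖v‖ ^ 2 ≤ RiemannianComparison.hessian ϱ p v v) := by
  -- The comparison only needs `h > 0` on the time interval of the curve.
  have hpos : ∀ p, (ϱ p : EReal) < dUp → ∀ t ∈ Icc 0 (ϱ p), 0 < h t := fun p hp t ht ↦
    hmax.pos t (hLow.trans_le (EReal.coe_nonneg.2 ht.1)) ((EReal.coe_le_coe ht.2).trans_lt hp)
  refine ⟨fun hcurv hinit p hp v hv hp0 hpd ↦ ?_, fun hcurv hinit p hp v hv hp0 hpd ↦ ?_⟩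
  · have := RiemannianComparison.hessian_comparison (σ := 1) (Or.inl rfl) hS hϱ hU hh hODE
      (fun q hq w hw hwn ↦ by linarith [hcurv q hq w hw hwn])
      (fun s hs w ↦ by linarith [hinit s hs w]) hp hp0 (hpos p hpd) hv
    linarith
  · have := RiemannianComparison.hessian_comparison (σ := -1) (Or.inr rfl) hS hϱ hU hh hODE
      (fun q hq w hw hwn ↦ by linarith [hcurv q hq w hw hwn])
      (fun s hs w ↦ by linarith [hinit s hs w]) hp hp0 (hpos p hpd) hv
    linarith
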